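/- Let $\mathbb{R}^5_1$ be $\mathbb{R}^5$ with the form $\langle x,y\rangle=\sum_{i=1}^4x^iy^i-x^5y^5$ and flat connection $\hat\nabla$, and let $\mathbb{H}^4=\{x:\langle x,x\rangle=-1,\ x^5>0\}$. Let $\varphi:M^2\to\mathbb{H}^4$ be a smooth immersion of a surface, with the induced metric, viewed also as a map $\Phi:M\to\mathbb{R}^5_1$. Let $H=\frac12\operatorname{trace}B$ be its mean curvature vector field in $\mathbb{H}^4$ and $f=|H|$. Assume that $\varphi$ is a (non-CMC) PNMC biconservative immersion, that is: $f>0$ and $\operatorname{grad}f\neq0$ everywhere on $M$; $H/|H|$ is parallel in the normal bundle of $\varphi$; the tangential part of the bitension field $\tau_2(\varphi)=-\Delta^\varphi\tau(\varphi)-\operatorname{trace}R^{\mathbb{H}^4}(\varphi_*\cdot,\tau(\varphi))\varphi_*\cdot$, $\tau(\varphi)=2H$, vanishes; and no non-empty open subset of $M$ is mapped into a totally geodesic hypersurface $\mathbb{H}^3\subset\mathbb{H}^4$. Let $E_1=\operatorname{grad}f/|\operatorname{grad}f|$ and let $E_2$ be a smooth vector field on $M$ such that $\{E_1,E_2\}$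 is an orthonormal frame field (for oriented $M$: the positively oriented one). Tangent vectors are identified with their images under $\Phi_*$. Assume that $\hat\nabla_{E_2}E_2$ is spacelike, i.e. $\langle\hat\nabla_{E_2}E_2,\hat\nabla_{E_2}E_2\rangle>0$ on $M$, and put $\hat\kappa=\sqrt{|\langle\hat\nabla_{E_2}E_2,\hat\nabla_{E_2}E_2\rangle|}$ and $\xi=\frac1{\hat\kappa}\hat\nabla_{E_2}E_2$. Let $\gamma:J\to M$ be an integral curve of $E_2$ on an open interval $J\ni0$, and let $\hat\gamma=\Phi\circ\gamma$. Then: (i) the curvature $\hat\kappa$ of $\hat\gamma$, $\hat\kappa=\sqrt{|\langle\hat\gamma'',\hat\gamma''\rangle|}$, is a positive constant along $\hat\gamma$; (ii) $\hat\nabla_{E_2}\xi=-\hat\kappa E_2$ on $M$; (iii) for all $v\in J$, $$\hat\gamma(v)=\overline B_0+\sin(\hat\kappa v)\,\overline B_1+\cos(\hat\kappa v)\,\overline B_2,$$ where $\hat\kappa$ is the constant of (i), $\overline B_0=\hat\gamma(0)+\frac1{\hat\kappa}\xi(0)$, $\overline B_1=\frac1{\hat\kappa}E_2(0)$, $\overline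 B_2=-\frac1{\hat\kappa}\xi(0)$ (values of $\xi$, $E_2$ at $\gamma(0)$), and $$\langle\overline B_1,\overline B_2\rangle=0,\qquad\langle\overline B_1,\overline B_1\rangle=\langle\overline B_2,\overline B_2\rangle=\frac1{\hat\kappa^2}.$$ In particular, $\overline B_0+\operatorname{span}\{\overline B_1,\overline B_2\}$ is a two-dimensional affine plane on which $\langle\cdot,\cdot\rangle$ is positive definite (a Euclidean plane), and $\hat\gamma$ lies on the circle of radius $1/\hat\kappa$ centred at $\overline B_0$ in this plane; its image is the whole circle as soon as $J$ contains a half-open interval $[a,a+2\pi/\hat\kappa)$. -/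

import Mathlib

open scoped Manifold ContDiff

noncomputable section

namespace PNMC

/-! ### Minkowski space and the hyperboloid model -/

/-- The vector space underlying the Minkowski space `ℝ⁵₁`; its norm plays no role below, the
geometry comes from the Lorentzian form `lor`. -/
abbrev Mink : Type := EuclideanSpace ℝ (Fin 5)

/-- The Lorentzian form `⟨x, y⟩ = x¹y¹ + x²y² + x³y³ + x⁴y⁴ - x⁵y⁵`. -/
def lor (x y : Mink) : ℝ :=
  (∑ i : Fin 4, x i.castSucc * y i.castSucc) - x (Fin.last 4) * y (Fin.last 4)

/-- The hyperboloid model of `ℍ⁴`: `⟨q, q⟩ = -1` and `q⁵ > 0`. -/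
def hyperboloid : Set Mink := {q | lor q q = -1 ∧ 0 < q (Fin.last 4)}

/-- For `q ∈ ℍ⁴`, the orthogonal projection of `ℝ⁵₁` onto `T_q ℍ⁴ = q^⊥`. -/
def hypProj (q w : Mink) : Mink := w + lor w q • q

/-- The Levi-Civita connection `∇̃_X Y` of `ℍ⁴`, for fields `X`, `Y` on `ℝ⁵₁` which are tangent to
`ℍ⁴` along `ℍ⁴`: the projection of the flat derivative (meaningful at points of `ℍ⁴`). -/
def hypNabla (X Y : Mink → Mink) (q : Mink) : Mink := hypProj q (fderiv ℝ Y q (X q))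

/-- The curvature `R(x, y)z = ([∇̃_X, ∇̃_Y] - ∇̃_[X,Y]) Z` of `ℍ⁴` at `q ∈ ℍ⁴`, for
`x, y, z ∈ T_q ℍ⁴` extended to the fields obtained by projecting the constant
fields `x`, `y`, `z` to the tangent spaces of `ℍ⁴`. -/
def hypCurvature (q x y z : Mink) : Mink :=
  let X : Mink → Mink := fun r => hypProj r x
  let Y : Mink → Mink := fun r => hypProj r y
  let Z : Mink → Mink := fun r => hypProj r z
  hypNabla X (hypNabla Y Z) q - hypNabla Y (hypNabla X Z) q
    - hypNabla (VectorField.lieBracket ℝ X Y) Z q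

/-! ### Submanifold geometry of a surface `Φ : M → ℍ⁴ ⊆ ℝ⁵₁` -/

section Surface

variable {M : Type*} [TopologicalSpace M] [ChartedSpace (EuclideanSpace ℝ (Fin 2)) M]

/-- The flat derivative `x ↦ ∇̂_x V` at `p` of a vector field `V : M → ℝ⁵₁` along the surface.
For `V = Φ` this is the differential of `Φ` at `p`. -/
def flatDeriv (V : M → Mink) (p : M) : TangentSpace (𝓡 2) p →L[ℝ] Mink :=
  mfderiv (𝓡 2) 𝓘(ℝ, Mink) V p

/-- The field `Φ_* X` along the surface. -/
def push (Φ : M → Mink) (X : (p : M) → TangentSpace (𝓡 2) p) (p : M) : Mink :=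
  flatDeriv Φ p (X p)

/-- The induced metric on `T_p M`. -/
def indMetric (Φ : M → Mink) (p : M) (x y : TangentSpace (𝓡 2) p) : ℝ :=
  lor (flatDeriv Φ p x) (flatDeriv Φ p y)

/-- The `i`-th vector of the coordinate basis of `T_p M`. -/
def coordVec (p : M) (i : Fin 2) : TangentSpace (𝓡 2) p :=
  (EuclideanSpace.single i (1 : ℝ) : EuclideanSpace ℝ (Fin 2))

/-- The matrix `(g_ij)` of the induced metric in the coordinate basis. -/
def gram (Φ : M → Mink) (p : M) : Matrix (Fin 2) (Fin 2) ℝ :=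
  Matrix.of fun i j => indMetric Φ p (coordVec p i) (coordVec p j)

/-- The trace `g^{ij} b(∂_i, ∂_j)` of a bilinear `b` on `T_p M` with respect to the induced
metric. -/
def metricTrace (Φ : M → Mink) (p : M)
    (b : TangentSpace (𝓡 2) p → TangentSpace (𝓡 2) p → Mink) : Mink :=
  ∑ i, ∑ j, (gram Φ p)⁻¹ i j • b (coordVec p i) (coordVec p j)

/-- The vector of `T_p M` dual to a linear form `α` on `T_p M` under the induced metric. -/
def sharp (Φ : M → Mink) (p : M) (α : TangentSpace (𝓡 2) p → ℝ) : TangentSpace (𝓡 2) p :=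
  ∑ i, ∑ j, ((gram Φ p)⁻¹ i j * α (coordVec p i)) • coordVec p j

/-- The gradient of a function with respect to the induced metric. -/
def gradient (Φ : M → Mink) (u : M → ℝ) (p : M) : TangentSpace (𝓡 2) p :=
  sharp Φ p fun x => (mfderiv (𝓡 2) 𝓘(ℝ, ℝ) u p x : ℝ)

/-- The component of `w ∈ ℝ⁵₁` tangent to the surface at `p`, as an element of `T_p M`. -/
def tangentPart (Φ : M → Mink) (p : M) (w : Mink) : TangentSpace (𝓡 2) p :=
  sharp Φ p fun x => lor w (flatDeriv Φ p x)

/-- The component of `w ∈ ℝ⁵₁` in the normal space, inside `T ℍ⁴`, of the surface at `p`. -/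
def normalPart (Φ : M → Mink) (p : M) (w : Mink) : Mink :=
  hypProj (Φ p) w - flatDeriv Φ p (tangentPart Φ p w)

/-- The pull-back connection `∇^φ_x V` on `φ⁻¹(T ℍ⁴)`. -/
def pullNabla (Φ : M → Mink) (V : M → Mink) (p : M) (x : TangentSpace (𝓡 2) p) : Mink :=
  hypProj (Φ p) (flatDeriv V p x)

/-- The normal connection `∇^⊥_x V` of the surface in `ℍ⁴`, for normal fields `V`. -/
def normalNabla (Φ : M → Mink) (V : M → Mink) (p : M) (x : TangentSpace (𝓡 2) p) : Mink :=
  normalPart Φ p (pullNabla Φ V p x)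

/-- The Levi-Civita connection `∇_x Y` of the induced metric: the tangential part of
`∇̃_x (Φ_* Y)`. -/
def surfNabla (Φ : M → Mink) (Y : (q : M) → TangentSpace (𝓡 2) q) (p : M)
    (x : TangentSpace (𝓡 2) p) : TangentSpace (𝓡 2) p :=
  tangentPart Φ p (pullNabla Φ (push Φ Y) p x)

variable [IsManifold (𝓡 2) ∞ M]

/-- A vector field on `M`, smooth near `p`, with the value `y` at `p`. -/
def extendVec {p : M} (y : TangentSpace (𝓡 2) p) : (q : M) → TangentSpace (𝓡 2) q :=
  FiberBundle.extend (EuclideanSpace ℝ (Fin 2)) y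

/-- The second fundamental form `B(x, y)` of the surface in `ℍ⁴`: the normal part of
`∇̃_x (Φ_* Y)`, where `Y` extends `y`. -/
def secondFF (Φ : M → Mink) (p : M) (x y : TangentSpace (𝓡 2) p) : Mink :=
  normalPart Φ p (pullNabla Φ (push Φ (extendVec y)) p x)

/-- The mean curvature vector field `H = (trace B) / 2`. -/
def meanCurv (Φ : M → Mink) (p : M) : Mink := (1 / 2 : ℝ) • metricTrace Φ p (secondFF Φ p)

/-- The mean curvature function `f = |H|`. -/
def meanCurvFun (Φ : M → Mink) (p : M) : ℝ := √(lor (meanCurv Φ p) (meanCurv Φ p))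

/-- The tension field `τ(φ) = 2H`. -/
def tension (Φ : M → Mink) (p : M) : Mink := (2 : ℝ) • meanCurv Φ p

/-- The rough Laplacian `Δ^φ V = - trace (∇^φ ∇^φ - ∇^φ_∇) V`. -/
def roughLaplacian (Φ : M → Mink) (V : M → Mink) (p : M) : Mink :=
  - metricTrace Φ p fun x y =>
      pullNabla Φ (fun q => pullNabla Φ V q (extendVec y q)) p x
        - pullNabla Φ V p (surfNabla Φ (extendVec y) p x)

/-- The bitension field `τ₂(φ) = - Δ^φ τ(φ) - trace R(φ_* ·, τ(φ)) φ_* ·`. -/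
def bitension (Φ : M → Mink) (p : M) : Mink :=
  - roughLaplacian Φ (tension Φ) p
    - metricTrace Φ p fun x y =>
        hypCurvature (Φ p) (flatDeriv Φ p x) (tension Φ p) (flatDeriv Φ p y)

/-- `Φ = ι ∘ φ` for a non-CMC, PNMC biconservative immersion `φ : M² → ℍ⁴`. -/
structure IsPNMCBiconservative (Φ : M → Mink) : Prop where
  smooth : ContMDiff (𝓡 2) 𝓘(ℝ, Mink) ∞ Φ
  mem_hyperboloid : ∀ p, Φ p ∈ hyperboloid
  immersion : ∀ p, Function.Injective (flatDeriv Φ p)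
  meanCurvFun_pos : ∀ p, 0 < meanCurvFun Φ p
  gradient_ne_zero : ∀ p, gradient Φ (meanCurvFun Φ) p ≠ 0
  /-- The normalized mean curvature vector field `H / |H|` is parallel in the normal bundle. -/
  parallel : ∀ p x, normalNabla Φ (fun q => (1 / meanCurvFun Φ q) • meanCurv Φ q) p x = 0
  /-- The tangential part of the bitension field vanishes. -/
  biconservative : ∀ p, tangentPart Φ p (bitension Φ p) = 0
  /-- No non-empty open part of the surface lies in a totally geodesic `ℍ³ = ℍ⁴ ∩ n^⊥`. -/
  full : ∀ U : Set M, IsOpen U → U.Nonempty → ∀ n : Mink, 0 < lor n n →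
    ¬ ∀ p ∈ U, lor (Φ p) n = 0

/-- The unit vector field `E₁ = grad f / |grad f|`. -/
def fieldE₁ (Φ : M → Mink) (p : M) : TangentSpace (𝓡 2) p :=
  (1 / √(indMetric Φ p (gradient Φ (meanCurvFun Φ) p) (gradient Φ (meanCurvFun Φ) p))) •
    gradient Φ (meanCurvFun Φ) p

/-- `E₂` is a smooth vector field completing `E₁` to an orthonormal frame field `{E₁, E₂}` of
`TM`. There is one such field for each of the two orientations of a connected `M`. -/
structure IsFieldE₂ (Φ : M → Mink) (E₂ : (p : M) → TangentSpace (𝓡 2) p) : Prop where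
  smooth : ContMDiff (𝓡 2) (𝓡 2).tangent ∞ fun p => (⟨p, E₂ p⟩ : TangentBundle (𝓡 2) M)
  unit : ∀ p, indMetric Φ p (E₂ p) (E₂ p) = 1
  orthogonal : ∀ p, indMetric Φ p (fieldE₁ Φ p) (E₂ p) = 0

/-- The field `∇̂_X X` along the surface. -/
def flatAccel (Φ : M → Mink) (X : (p : M) → TangentSpace (𝓡 2) p) (p : M) : Mink :=
  flatDeriv (push Φ X) p (X p)

/-- The function `κ̂ = √|⟨∇̂_X X, ∇̂_X X⟩|`. -/
def kappaHat (Φ : M → Mink) (X : (p : M) → TangentSpace (𝓡 2) p) (p : M) : ℝ :=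
  √|lor (flatAccel Φ X p) (flatAccel Φ X p)|

/-- The field `ξ = (1/κ̂) ∇̂_X X`. -/
def xiField (Φ : M → Mink) (X : (p : M) → TangentSpace (𝓡 2) p) (p : M) : Mink :=
  (1 / kappaHat Φ X p) • flatAccel Φ X p

end Surface

/-! ### Curves and planes in Minkowski space -/

/-- The curvature `√|⟨c'', c''⟩|` of a curve `c` in `ℝ⁵₁` parametrized by arc length. -/
def curveCurvature (c : ℝ → Mink) (v : ℝ) : ℝ :=
  √|lor (deriv (deriv c) v) (deriv (deriv c) v)|

/-- `P` is a two-dimensional affine subspace of `ℝ⁵₁` on which the Lorentzian form is positive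
definite. -/
def IsEuclideanPlane (P : AffineSubspace ℝ Mink) : Prop :=
  Module.finrank ℝ P.direction = 2 ∧ ∀ w ∈ P.direction, w ≠ 0 → 0 < lor w w

/-- The circle with centre `c` and radius `r` in the plane `P`. -/
def circleIn (P : AffineSubspace ℝ Mink) (c : Mink) (r : ℝ) : Set Mink :=
  {x | x ∈ P ∧ lor (x - c) (x - c) = r ^ 2}

end PNMC

end

noncomputable section

namespace PNMC

/-! ### The Lorentzian form -/

section Lorentz

variable (x y z : Mink) (c : ℝ)

/-! Write `e₁, e₂` for the images in `ℝ⁵₁` of an orthonormal frame whose second vector is `E₂` and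
whose first is therefore `±E₁`, `D₁, D₂` for flat derivatives along it, `n = H / f`, `a = ⟨D₁e₁,
e₂⟩` and `w = ⟨D₂e₂, e₁⟩`. Everything rests on the identity `D₂D₂e₂ = -⟨D₂e₂, D₂e₂⟩ e₂`
(`deriv_accel`, globally `flatDeriv_flatAccel`). As `D₂e₂ ⟂ e₂`, it makes `κ̂` constant along `E₂`
and gives `D₂ξ = -κ̂ e₂`. Along an integral curve this is the linear system `c' = e`, `e' = κξ`, `ξ'
= -κe`, whose solutions are circles (`circle_ode`).

The identity needs only that `D₂D₂e₂` is a multiple of `e₂`; the factor is then found by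
differentiating `⟨D₂e₂, e₂⟩ = 0`. Since `n` is parallel, `D₁n` and `D₂n` are tangent. The Codazzi
equation turns the divergence of the shape operator `A` of `n` into the differential of its trace
`2f`, so the biconservative equation becomes `A(grad f) = -f grad f`, and `A = diag(-f, 3f)`
(`shape_eq`). Commuting `D₁, D₂` on `n` and on the position vector `v` then yields `a = 0`, `4fw = 3
D₁f`, `D₁e₂ = 0` and `D₂e₁ = -w e₂` (`connection`); the normal component is the Ricci equation.
Because `D₂f = 0`, also `D₂D₁f = 0` and `D₂w = 0`. Finally `D₂e₂ = w e₁ + 2f n + 2v - D₁e₁`, and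
`D₂` sends each term on the right to a multiple of `e₂`.

The remaining work connects these frame equations with the geometric definitions, which use
coordinate traces and arbitrary extensions of tangent vectors. In a chart the terms depending on the
extension are tangent or cancel, and traces can be taken in the orthonormal frame; the outcome is
`isBiconservativeFrame`. -/

theorem lor_comm : lor x y = lor y x := by
  simp [lor, mul_comm]

theorem lor_add_left : lor (x + y) z = lor x z + lor y z := by
  simp [lor, add_mul, Finset.sum_add_distrib]; ring

theorem lor_smul_left : lor (c • x) y = c * lor x y := by
  simp [lor, mul_assoc, ← Finset.mul_sum, mul_sub]

theorem lor_add_right : lor x (y + z) = lor x y + lor x z := by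
  rw [lor_comm, lor_add_left, lor_comm y, lor_comm z]

theorem lor_smul_right : lor x (c • y) = c * lor x y := by
  rw [lor_comm, lor_smul_left, lor_comm]

theorem lor_neg_left : lor (-x) y = -lor x y := by
  simpa using lor_smul_left x y (-1)

theorem lor_neg_right : lor x (-y) = -lor x y := by
  rw [lor_comm, lor_neg_left, lor_comm]

theorem lor_sub_left : lor (x - y) z = lor x z - lor y z := by
  rw [sub_eq_add_neg, lor_add_left, lor_neg_left, sub_eq_add_neg]

@[simp] theorem lor_zero_left : lor 0 y = 0 := by simp [lor]

@[simp] theorem lor_zero_right : lor x 0 = 0 := by simp [lor]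

/-- The Lorentzian form as a continuous bilinear map. -/
def lorL : Mink →L[ℝ] Mink →L[ℝ] ℝ :=
  LinearMap.toContinuousBilinearMap
    (LinearMap.mk₂ ℝ lor lor_add_left (fun c x y => lor_smul_left x y c) lor_add_right
      (fun c x y => lor_smul_right x y c))

theorem lorL_apply : lorL x y = lor x y := rfl

variable {x y z c}

/-- The Lorentzian form is positive definite on the orthogonal complement of a unit timelike
vector. -/
theorem lor_self_pos {q w : Mink} (hq : lor q q = -1) (hwq : lor w q = 0) (hw : w ≠ 0) :
    0 < lor w w := by
  have cs := Finset.sum_mul_sq_le_sq_mul_sq (Finset.univ : Finset (Fin 4))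
    (fun i => w i.castSucc) (fun i => q i.castSucc)
  have hS : (0 : ℝ) ≤ ∑ i : Fin 4, w i.castSucc ^ 2 :=
    Finset.sum_nonneg fun i _ => sq_nonneg _
  have hQ : (0 : ℝ) ≤ ∑ i : Fin 4, q i.castSucc ^ 2 :=
    Finset.sum_nonneg fun i _ => sq_nonneg _
  have e1 : ∑ i : Fin 4, q i.castSucc ^ 2 = q (Fin.last 4) ^ 2 - 1 := by
    simp only [lor, ← pow_two] at hq; linarith
  have e2 : ∑ i : Fin 4, w i.castSucc * q i.castSucc = w (Fin.last 4) * q (Fin.last 4) := by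
    simp only [lor] at hwq; linarith
  have e3 : lor w w = ∑ i : Fin 4, w i.castSucc ^ 2 - w (Fin.last 4) ^ 2 := by
    simp only [lor, ← pow_two]
  rw [e2, e1] at cs
  rw [e1] at hQ
  rw [e3]
  -- Reversed Cauchy–Schwarz: with `S` the spatial square sum of `w`, `cs` reads `(w⁵q⁵)² ≤ S((q⁵)²
  -- - 1)`. If `S ≤ (w⁵)²`, this forces `S = 0`, and then `w⁵ = 0` because `(q⁵)² ≥ 1`.
  by_contra hneg
  push Not at hneg
  have hS0 : ∑ i : Fin 4, w i.castSucc ^ 2 = 0 := by nlinarith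
  have hl0 : w (Fin.last 4) ^ 2 = 0 := by
    rw [hS0] at cs
    nlinarith [sq_nonneg (w (Fin.last 4))]
  refine hw ?_
  ext i
  refine Fin.lastCases ?_ (fun j => ?_) i
  · simpa using hl0
  · have := (Finset.sum_eq_zero_iff_of_nonneg (fun i _ => sq_nonneg _)).1 hS0 j (Finset.mem_univ j)
    simpa using this

end Lorentz

/-! ### Product rule for the Lorentzian form. -/

section LorentzCalculus

variable {E : Type*} [NormedAddCommGroup E] [NormedSpace ℝ E] {V W : E → Mink} {z : E}

theorem _root_.ContDiffOn.lor {n : WithTop ℕ∞} {s : Set E} (hV : ContDiffOn ℝ n V s)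
    (hW : ContDiffOn ℝ n W s) : ContDiffOn ℝ n (fun z => lor (V z) (W z)) s :=
  ((lorL.contDiff.comp_contDiffOn hV)).clm_apply hW

theorem _root_.DifferentiableAt.lor (hV : DifferentiableAt ℝ V z) (hW : DifferentiableAt ℝ W z) :
    DifferentiableAt ℝ (fun z => lor (V z) (W z)) z :=
  (lorL.differentiableAt.comp z hV).clm_apply hW

theorem fderiv_lor (hV : DifferentiableAt ℝ V z) (hW : DifferentiableAt ℝ W z) (x : E) :
    fderiv ℝ (fun z => lor (V z) (W z)) z x
      = lor (fderiv ℝ V z x) (W z) + lor (V z) (fderiv ℝ W z x) := by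
  have h := (lorL.hasFDerivAt.comp z hV.hasFDerivAt).clm_apply hW.hasFDerivAt
  have h2 := h.fderiv
  change fderiv ℝ (fun z => PNMC.lor (V z) (W z)) z = _ at h2
  rw [h2]
  simp [lorL_apply, add_comm]

end LorentzCalculus

/-! ### Derivatives along vector fields -/

section DirDeriv

variable {E F : Type*} [NormedAddCommGroup E] [NormedSpace ℝ E]
  [NormedAddCommGroup F] [NormedSpace ℝ F]

/-- The derivative of `W` along the vector field `x`. -/
def dirDeriv (x : E → E) (W : E → F) (z : E) : F := fderiv ℝ W z (x z)

variable {Ω : Set E} {x y : E → E} {W : E → F} {z : E}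

theorem differentiableAt_of_contDiffOn (hΩ : IsOpen Ω) (hW : ContDiffOn ℝ ∞ W Ω) (hz : z ∈ Ω) :
    DifferentiableAt ℝ W z :=
  (hW.contDiffAt (hΩ.mem_nhds hz)).differentiableAt (by simp)

theorem contDiffOn_dirDeriv (hΩ : IsOpen Ω) (hx : ContDiffOn ℝ ∞ x Ω) (hW : ContDiffOn ℝ ∞ W Ω) :
    ContDiffOn ℝ ∞ (dirDeriv x W) Ω :=
  (hW.fderiv_of_isOpen hΩ (by simp)).clm_apply hx

theorem dirDeriv_congr (hΩ : IsOpen Ω) {V W : E → F} (h : ∀ z ∈ Ω, V z = W z) (hz : z ∈ Ω) :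
    dirDeriv x V z = dirDeriv x W z := by
  have : V =ᶠ[nhds z] W := by
    filter_upwards [hΩ.mem_nhds hz] with q hq using h q hq
  simp only [dirDeriv, this.fderiv_eq]

theorem dirDeriv_const (c : F) : dirDeriv x (fun _ => c) z = 0 := by
  simp [dirDeriv]

theorem dirDeriv_add {V W : E → F} (hV : DifferentiableAt ℝ V z) (hW : DifferentiableAt ℝ W z) :
    dirDeriv x (fun z => V z + W z) z = dirDeriv x V z + dirDeriv x W z := by
  simp [dirDeriv, fderiv_fun_add hV hW]

theorem dirDeriv_sub {V W : E → F} (hV : DifferentiableAt ℝ V z) (hW : DifferentiableAt ℝ W z) :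
    dirDeriv x (fun z => V z - W z) z = dirDeriv x V z - dirDeriv x W z := by
  simp [dirDeriv, fderiv_fun_sub hV hW]

theorem dirDeriv_smul {c : E → ℝ} {W : E → F} (hc : DifferentiableAt ℝ c z)
    (hW : DifferentiableAt ℝ W z) :
    dirDeriv x (fun z => c z • W z) z = dirDeriv x c z • W z + c z • dirDeriv x W z := by
  simp [dirDeriv, fderiv_fun_smul hc hW, add_comm]

theorem dirDeriv_lor {V W : E → Mink} (hV : DifferentiableAt ℝ V z) (hW : DifferentiableAt ℝ W z) :
    dirDeriv x (fun z => lor (V z) (W z)) z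
      = lor (dirDeriv x V z) (W z) + lor (V z) (dirDeriv x W z) :=
  fderiv_lor hV hW _

theorem dirDeriv_dirDeriv (hx : DifferentiableAt ℝ y z)
    (hW : DifferentiableAt ℝ (fderiv ℝ W) z) :
    dirDeriv x (dirDeriv y W) z
      = fderiv ℝ (fderiv ℝ W) z (x z) (y z) + fderiv ℝ W z (fderiv ℝ y z (x z)) := by
  have := (hW.hasFDerivAt.clm_apply hx.hasFDerivAt).fderiv
  change fderiv ℝ (dirDeriv y W) z = _ at this
  rw [dirDeriv, this]
  simp [add_comm]

theorem fderiv_fderiv_eq (hΩ : IsOpen Ω) (hy : ContDiffOn ℝ ∞ y Ω) (hW : ContDiffOn ℝ ∞ W Ω)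
    (hz : z ∈ Ω) :
    fderiv ℝ (fderiv ℝ W) z (x z) (y z)
      = dirDeriv x (dirDeriv y W) z - fderiv ℝ W z (fderiv ℝ y z (x z)) := by
  rw [dirDeriv_dirDeriv (differentiableAt_of_contDiffOn hΩ hy hz)
    (differentiableAt_of_contDiffOn hΩ (hW.fderiv_of_isOpen (m := ∞) hΩ (by simp)) hz)]
  abel

theorem fderiv_fderiv_comm (hW : ContDiffAt ℝ ∞ W z) (u v : E) :
    fderiv ℝ (fderiv ℝ W) z u v = fderiv ℝ (fderiv ℝ W) z v u :=
  hW.isSymmSndFDerivAt (by simp; exact WithTop.coe_le_coe.2 le_top) u v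

/-- The second derivatives of `W` cancel by symmetry; what is left is `dW` applied to the Lie
bracket. Flatness of `ℝ⁵₁` enters the argument here: applied to `v`, `n` and `e₁`, this replaces the
Gauss, Codazzi and Ricci equations. -/
theorem dirDeriv_commutator (hΩ : IsOpen Ω) (hx : ContDiffOn ℝ ∞ x Ω) (hy : ContDiffOn ℝ ∞ y Ω)
    (hW : ContDiffOn ℝ ∞ W Ω) (hz : z ∈ Ω) :
    dirDeriv x (dirDeriv y W) z - dirDeriv y (dirDeriv x W) z
      = fderiv ℝ W z (fderiv ℝ y z (x z) - fderiv ℝ x z (y z)) := by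
  have h1 := differentiableAt_of_contDiffOn hΩ hx hz
  have h2 := differentiableAt_of_contDiffOn hΩ hy hz
  have h3 := differentiableAt_of_contDiffOn hΩ (hW.fderiv_of_isOpen (m := ∞) hΩ (by simp)) hz
  rw [dirDeriv_dirDeriv h2 h3, dirDeriv_dirDeriv h1 h3,
    fderiv_fderiv_comm (hW.contDiffAt (hΩ.mem_nhds hz)) (x z), map_sub]
  abel

end DirDeriv

/-! ### The local computation in an orthonormal frame -/

section LocalFrame

variable {E : Type*} [NormedAddCommGroup E] [NormedSpace ℝ E]

/-- The projection of `w` orthogonal to the timelike unit vector `q` and to the orthonormal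
vectors `a`, `b`. -/
def frameNormal (q a b w : Mink) : Mink := w + lor w q • q - (lor w a • a + lor w b • b)

/-- A smooth surface `v : Ω → ℍ⁴` with an orthonormal frame field `x₁, x₂`. -/
structure IsOrthonormalFrame (Ω : Set E) (v : E → Mink) (x₁ x₂ : E → E) : Prop where
  isOpen : IsOpen Ω
  smooth : ContDiffOn ℝ ∞ v Ω
  smooth₁ : ContDiffOn ℝ ∞ x₁ Ω
  smooth₂ : ContDiffOn ℝ ∞ x₂ Ω
  hyp : ∀ z ∈ Ω, lor (v z) (v z) = -1
  unit₁ : ∀ z ∈ Ω, lor (dirDeriv x₁ v z) (dirDeriv x₁ v z) = 1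
  unit₂ : ∀ z ∈ Ω, lor (dirDeriv x₂ v z) (dirDeriv x₂ v z) = 1
  orth : ∀ z ∈ Ω, lor (dirDeriv x₁ v z) (dirDeriv x₂ v z) = 0
  span : ∀ z ∈ Ω, ∀ u : E, u = lor (fderiv ℝ v z u) (dirDeriv x₁ v z) • x₁ z
    + lor (fderiv ℝ v z u) (dirDeriv x₂ v z) • x₂ z

/-- The frame form of the equations of a PNMC biconservative surface: `n` is the unit vector of
the mean curvature field `f n`, it is parallel in the normal bundle, the tangential part of the
bitension field vanishes and `x₁` is the direction of the gradient of `f`. -/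
structure IsBiconservativeFrame (Ω : Set E) (v : E → Mink) (x₁ x₂ : E → E) (f : E → ℝ)
    (n : E → Mink) : Prop extends IsOrthonormalFrame Ω v x₁ x₂ where
  smooth_f : ContDiffOn ℝ ∞ f Ω
  smooth_n : ContDiffOn ℝ ∞ n Ω
  f_pos : ∀ z ∈ Ω, 0 < f z
  n_unit : ∀ z ∈ Ω, lor (n z) (n z) = 1
  n_v : ∀ z ∈ Ω, lor (n z) (v z) = 0
  n_e₁ : ∀ z ∈ Ω, lor (n z) (dirDeriv x₁ v z) = 0
  n_e₂ : ∀ z ∈ Ω, lor (n z) (dirDeriv x₂ v z) = 0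
  mean : ∀ z ∈ Ω, frameNormal (v z) (dirDeriv x₁ v z) (dirDeriv x₂ v z)
    (dirDeriv x₁ (dirDeriv x₁ v) z + dirDeriv x₂ (dirDeriv x₂ v) z) = (2 * f z) • n z
  parallel₁ : ∀ z ∈ Ω, frameNormal (v z) (dirDeriv x₁ v z) (dirDeriv x₂ v z) (dirDeriv x₁ n z) = 0
  parallel₂ : ∀ z ∈ Ω, frameNormal (v z) (dirDeriv x₁ v z) (dirDeriv x₂ v z) (dirDeriv x₂ n z) = 0
  bicons : ∀ z ∈ Ω, ∀ e ∈ ({dirDeriv x₁ v z, dirDeriv x₂ v z} : Set Mink),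
    lor (dirDeriv x₁ (dirDeriv x₁ fun z => f z • n z) z
      + dirDeriv x₂ (dirDeriv x₂ fun z => f z • n z) z
      - (lor (dirDeriv x₁ (dirDeriv x₁ v) z) (dirDeriv x₂ v z) •
          dirDeriv x₂ (fun z => f z • n z) z
        + lor (dirDeriv x₂ (dirDeriv x₂ v) z) (dirDeriv x₁ v z) •
          dirDeriv x₁ (fun z => f z • n z) z)) e = 0
  df₁ : ∀ z ∈ Ω, dirDeriv x₁ f z ≠ 0
  df₂ : ∀ z ∈ Ω, dirDeriv x₂ f z = 0

/-- Source of all the skew-symmetry relations between connection coefficients, and of the relations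
between second fundamental form and shape operator. -/
theorem dirDeriv_lor_of_const {Ω : Set E} {x : E → E} {V W : E → Mink} {z : E} {c : ℝ}
    (hΩ : IsOpen Ω) (hV : ContDiffOn ℝ ∞ V Ω) (hW : ContDiffOn ℝ ∞ W Ω)
    (h : ∀ z ∈ Ω, lor (V z) (W z) = c) (hz : z ∈ Ω) :
    lor (dirDeriv x V z) (W z) = -lor (V z) (dirDeriv x W z) := by
  have h1 := dirDeriv_lor (x := x) (differentiableAt_of_contDiffOn hΩ hV hz)
    (differentiableAt_of_contDiffOn hΩ hW hz)
  rw [dirDeriv_congr hΩ h hz, dirDeriv_const] at h1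
  linarith

/-! ### Connection coefficients of an orthonormal frame. -/

namespace IsOrthonormalFrame

variable {Ω : Set E} {v : E → Mink} {x₁ x₂ : E → E} {z : E}

theorem smooth_e₁ (h : IsOrthonormalFrame Ω v x₁ x₂) : ContDiffOn ℝ ∞ (dirDeriv x₁ v) Ω :=
  contDiffOn_dirDeriv h.isOpen h.smooth₁ h.smooth

theorem smooth_e₂ (h : IsOrthonormalFrame Ω v x₁ x₂) : ContDiffOn ℝ ∞ (dirDeriv x₂ v) Ω :=
  contDiffOn_dirDeriv h.isOpen h.smooth₂ h.smooth

theorem lor_e_v (h : IsOrthonormalFrame Ω v x₁ x₂) (hz : z ∈ Ω) (x : E → E) :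
    lor (dirDeriv x v z) (v z) = 0 := by
  have := dirDeriv_lor_of_const (x := x) h.isOpen h.smooth h.smooth h.hyp hz
  rw [lor_comm (v z)] at this
  linarith

theorem lor_De₁_e₁ (h : IsOrthonormalFrame Ω v x₁ x₂) (hz : z ∈ Ω) (x : E → E) :
    lor (dirDeriv x (dirDeriv x₁ v) z) (dirDeriv x₁ v z) = 0 := by
  have := dirDeriv_lor_of_const (x := x) h.isOpen h.smooth_e₁ h.smooth_e₁ h.unit₁ hz
  rw [lor_comm (dirDeriv x₁ v z)] at this
  linarith

theorem lor_De₂_e₂ (h : IsOrthonormalFrame Ω v x₁ x₂) (hz : z ∈ Ω) (x : E → E) :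
    lor (dirDeriv x (dirDeriv x₂ v) z) (dirDeriv x₂ v z) = 0 := by
  have := dirDeriv_lor_of_const (x := x) h.isOpen h.smooth_e₂ h.smooth_e₂ h.unit₂ hz
  rw [lor_comm (dirDeriv x₂ v z)] at this
  linarith

theorem lor_De₂_e₁ (h : IsOrthonormalFrame Ω v x₁ x₂) (hz : z ∈ Ω) (x : E → E) :
    lor (dirDeriv x (dirDeriv x₂ v) z) (dirDeriv x₁ v z)
      = -lor (dirDeriv x (dirDeriv x₁ v) z) (dirDeriv x₂ v z) := by
  rw [lor_comm,
    dirDeriv_lor_of_const (x := x) h.isOpen h.smooth_e₁ h.smooth_e₂ h.orth hz, lor_comm, neg_neg]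

theorem lor_De₁_v (h : IsOrthonormalFrame Ω v x₁ x₂) (hz : z ∈ Ω) (x : E → E) :
    lor (dirDeriv x (dirDeriv x₁ v) z) (v z) = -lor (dirDeriv x₁ v z) (dirDeriv x v z) :=
  dirDeriv_lor_of_const (x := x) h.isOpen h.smooth_e₁ h.smooth (fun _ hz => h.lor_e_v hz _) hz

theorem lor_De₂_v (h : IsOrthonormalFrame Ω v x₁ x₂) (hz : z ∈ Ω) (x : E → E) :
    lor (dirDeriv x (dirDeriv x₂ v) z) (v z) = -lor (dirDeriv x₂ v z) (dirDeriv x v z) :=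
  dirDeriv_lor_of_const (x := x) h.isOpen h.smooth_e₂ h.smooth (fun _ hz => h.lor_e_v hz _) hz

/-- The commutator of derivatives along the frame, in terms of the connection coefficients. -/
theorem commutator {F : Type*} [NormedAddCommGroup F] [NormedSpace ℝ F]
    (h : IsOrthonormalFrame Ω v x₁ x₂) (hz : z ∈ Ω) {W : E → F} (hW : ContDiffOn ℝ ∞ W Ω) :
    dirDeriv x₁ (dirDeriv x₂ W) z - dirDeriv x₂ (dirDeriv x₁ W) z
      = -lor (dirDeriv x₁ (dirDeriv x₁ v) z) (dirDeriv x₂ v z) • dirDeriv x₁ W z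
        + lor (dirDeriv x₂ (dirDeriv x₂ v) z) (dirDeriv x₁ v z) • dirDeriv x₂ W z := by
  have hv := dirDeriv_commutator h.isOpen h.smooth₁ h.smooth₂ h.smooth hz
  -- The bracket `[x₁, x₂]` is expanded in the frame; its coefficients come from the commutator
  -- formula for `v` itself, that is, from `D₁e₂ - D₂e₁`.
  have hs := h.span z hz (fderiv ℝ x₂ z (x₁ z) - fderiv ℝ x₁ z (x₂ z))
  rw [← hv, lor_sub_left, lor_sub_left, h.lor_De₂_e₁ hz, h.lor_De₁_e₁ hz, h.lor_De₂_e₂ hz] at hs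
  have h21 := h.lor_De₂_e₁ hz x₂
  rw [dirDeriv_commutator h.isOpen h.smooth₁ h.smooth₂ hW hz, hs, map_add, map_smul, map_smul]
  simp only [dirDeriv] at h21 ⊢
  rw [h21]
  simp

end IsOrthonormalFrame

/-! ### Codazzi, Ricci and biconservative equations in the frame. -/

namespace IsBiconservativeFrame

variable {Ω : Set E} {v : E → Mink} {x₁ x₂ : E → E} {f : E → ℝ} {n : E → Mink} {z : E}

theorem lor_Dn_e₁ (h : IsBiconservativeFrame Ω v x₁ x₂ f n) (hz : z ∈ Ω) (x : E → E) :
    lor (dirDeriv x n z) (dirDeriv x₁ v z) = -lor (dirDeriv x (dirDeriv x₁ v) z) (n z) := by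
  rw [dirDeriv_lor_of_const (x := x) h.isOpen h.smooth_n h.smooth_e₁ h.n_e₁ hz, lor_comm]

theorem lor_Dn_e₂ (h : IsBiconservativeFrame Ω v x₁ x₂ f n) (hz : z ∈ Ω) (x : E → E) :
    lor (dirDeriv x n z) (dirDeriv x₂ v z) = -lor (dirDeriv x (dirDeriv x₂ v) z) (n z) := by
  rw [dirDeriv_lor_of_const (x := x) h.isOpen h.smooth_n h.smooth_e₂ h.n_e₂ hz, lor_comm]

/-- The shape operator in the direction `n` is symmetric. -/
theorem shape_symm (h : IsBiconservativeFrame Ω v x₁ x₂ f n) (hz : z ∈ Ω) :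
    lor (dirDeriv x₂ n z) (dirDeriv x₁ v z) = lor (dirDeriv x₁ n z) (dirDeriv x₂ v z) := by
  -- The commutator formula for `v` says that `D₁e₂ - D₂e₁` is tangent, hence orthogonal to `n`.
  have := congrArg (fun w => lor w (n z)) (h.commutator hz h.smooth)
  simp only [lor_sub_left, lor_add_left, lor_smul_left, lor_comm (dirDeriv x₁ v z) (n z),
    lor_comm (dirDeriv x₂ v z) (n z), h.n_e₁ z hz, h.n_e₂ z hz] at this
  rw [h.lor_Dn_e₁ hz, h.lor_Dn_e₂ hz]
  linarith

/-- The trace of the shape operator in the direction `n`. -/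
theorem shape_trace (h : IsBiconservativeFrame Ω v x₁ x₂ f n) (hz : z ∈ Ω) :
    lor (dirDeriv x₁ n z) (dirDeriv x₁ v z) + lor (dirDeriv x₂ n z) (dirDeriv x₂ v z)
      = -(2 * f z) := by
  have := congrArg (fun w => lor w (n z)) (h.mean z hz)
  simp only [frameNormal, lor_sub_left, lor_add_left, lor_smul_left, h.n_unit z hz,
    lor_comm (v z) (n z), lor_comm (dirDeriv x₁ v z) (n z), lor_comm (dirDeriv x₂ v z) (n z),
    h.n_v z hz, h.n_e₁ z hz, h.n_e₂ z hz] at this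
  rw [h.lor_Dn_e₁ hz, h.lor_Dn_e₂ hz]
  linarith

/-- Parallelism removes the part of `D n` normal to the surface inside `ℍ⁴`, and the `v`-component
vanishes because `⟨D n, v⟩ = -⟨n, D v⟩`. So the flat derivative of `n` is tangent to the surface. -/
theorem Dn_eq (h : IsBiconservativeFrame Ω v x₁ x₂ f n) (hz : z ∈ Ω) {x : E → E}
    (hx : frameNormal (v z) (dirDeriv x₁ v z) (dirDeriv x₂ v z) (dirDeriv x n z) = 0)
    (hx' : lor (n z) (dirDeriv x v z) = 0) :
    dirDeriv x n z = lor (dirDeriv x n z) (dirDeriv x₁ v z) • dirDeriv x₁ v z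
      + lor (dirDeriv x n z) (dirDeriv x₂ v z) • dirDeriv x₂ v z := by
  have h0 : lor (dirDeriv x n z) (v z) = 0 := by
    rw [dirDeriv_lor_of_const (x := x) h.isOpen h.smooth_n h.smooth h.n_v hz, hx', neg_zero]
  rw [frameNormal, h0, zero_smul, add_zero] at hx
  exact sub_eq_zero.1 hx

theorem smooth_Dn₁ (h : IsBiconservativeFrame Ω v x₁ x₂ f n) : ContDiffOn ℝ ∞ (dirDeriv x₁ n) Ω :=
  contDiffOn_dirDeriv h.isOpen h.smooth₁ h.smooth_n

theorem smooth_Dn₂ (h : IsBiconservativeFrame Ω v x₁ x₂ f n) : ContDiffOn ℝ ∞ (dirDeriv x₂ n) Ω :=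
  contDiffOn_dirDeriv h.isOpen h.smooth₂ h.smooth_n

/-- In the frame `x₁, x₂` the shape operator in the direction `n` is `diag (-f, 3 f)`. -/
theorem shape_eq (h : IsBiconservativeFrame Ω v x₁ x₂ f n) (hz : z ∈ Ω) :
    dirDeriv x₁ n z = f z • dirDeriv x₁ v z ∧
      dirDeriv x₂ n z = (-(3 * f z)) • dirDeriv x₂ v z := by
  set s₁₁ : E → ℝ := fun z => lor (dirDeriv x₁ n z) (dirDeriv x₁ v z) with hs₁₁
  set s₁₂ : E → ℝ := fun z => lor (dirDeriv x₁ n z) (dirDeriv x₂ v z) with hs₁₂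
  set s₂₂ : E → ℝ := fun z => lor (dirDeriv x₂ n z) (dirDeriv x₂ v z) with hs₂₂
  have c₁₁ : ContDiffOn ℝ ∞ s₁₁ Ω := h.smooth_Dn₁.lor h.smooth_e₁
  have c₁₂ : ContDiffOn ℝ ∞ s₁₂ Ω := h.smooth_Dn₁.lor h.smooth_e₂
  have c₂₂ : ContDiffOn ℝ ∞ s₂₂ Ω := h.smooth_Dn₂.lor h.smooth_e₂
  have n₁ : ∀ q ∈ Ω, dirDeriv x₁ n q = s₁₁ q • dirDeriv x₁ v q + s₁₂ q • dirDeriv x₂ v q :=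
    fun q hq => h.Dn_eq hq (h.parallel₁ q hq) (h.n_e₁ q hq)
  have n₂ : ∀ q ∈ Ω, dirDeriv x₂ n q = s₁₂ q • dirDeriv x₁ v q + s₂₂ q • dirDeriv x₂ v q :=
    fun q hq => (h.Dn_eq hq (h.parallel₂ q hq) (h.n_e₂ q hq)).trans (by
      rw [h.shape_symm hq])
  have tr : ∀ q ∈ Ω, s₁₁ q + s₂₂ q = (-2 : ℝ) • f q := fun q hq => by
    rw [smul_eq_mul, ← neg_mul_eq_neg_mul, ← h.shape_trace hq]
  have dA : ∀ {F : Type} [NormedAddCommGroup F] [NormedSpace ℝ F] {W : E → F},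
      ContDiffOn ℝ ∞ W Ω → ∀ {q}, q ∈ Ω → DifferentiableAt ℝ W q := fun hW _ hq =>
    differentiableAt_of_contDiffOn h.isOpen hW hq
  have dtr : ∀ x : E → E, ∀ q ∈ Ω,
      dirDeriv x s₁₁ q + dirDeriv x s₂₂ q = -2 * dirDeriv x f q := fun x q hq => by
    rw [← dirDeriv_add (dA c₁₁ hq) (dA c₂₂ hq), dirDeriv_congr h.isOpen tr hq,
      dirDeriv_smul (differentiableAt_const _) (dA h.smooth_f hq), dirDeriv_const]
    simp
  -- second derivatives of `n`
  have comb : ∀ {b c : E → ℝ}, ContDiffOn ℝ ∞ b Ω → ContDiffOn ℝ ∞ c Ω → ∀ x : E → E,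
      dirDeriv x (fun q => b q • dirDeriv x₁ v q + c q • dirDeriv x₂ v q) z
        = (dirDeriv x b z • dirDeriv x₁ v z + b z • dirDeriv x (dirDeriv x₁ v) z)
          + (dirDeriv x c z • dirDeriv x₂ v z + c z • dirDeriv x (dirDeriv x₂ v) z) := by
    intro b c hb hc x
    rw [dirDeriv_add ((dA hb hz).fun_smul (dA h.smooth_e₁ hz))
        ((dA hc hz).fun_smul (dA h.smooth_e₂ hz)),
      dirDeriv_smul (dA hb hz) (dA h.smooth_e₁ hz), dirDeriv_smul (dA hc hz) (dA h.smooth_e₂ hz)]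
  have D₁₁ := (dirDeriv_congr (x := x₁) h.isOpen n₁ hz).trans (comb c₁₁ c₁₂ x₁)
  have D₂₁ := (dirDeriv_congr (x := x₂) h.isOpen n₁ hz).trans (comb c₁₁ c₁₂ x₂)
  have D₁₂ := (dirDeriv_congr (x := x₁) h.isOpen n₂ hz).trans (comb c₁₂ c₂₂ x₁)
  have D₂₂ := (dirDeriv_congr (x := x₂) h.isOpen n₂ hz).trans (comb c₁₂ c₂₂ x₂)
  -- Pairing this with `e₁` and `e₂` gives the two Codazzi equations `com₁`, `com₂` for `sᵢⱼ = ⟨Dᵢn,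
  -- eⱼ⟩`.
  have com := h.commutator hz h.smooth_n
  rw [D₁₂, D₂₁, n₁ z hz, n₂ z hz] at com
  have u₁ := h.unit₁ z hz
  have u₂ := h.unit₂ z hz
  have o := h.orth z hz
  have o' := o
  rw [lor_comm] at o'
  have a21 := h.lor_De₂_e₁ hz
  have a11 := h.lor_De₁_e₁ hz
  have a22 := h.lor_De₂_e₂ hz
  have w₂ : lor (dirDeriv x₂ (dirDeriv x₁ v) z) (dirDeriv x₂ v z)
      = -lor (dirDeriv x₂ (dirDeriv x₂ v) z) (dirDeriv x₁ v z) := by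
    rw [a21, neg_neg]
  have com₁ := congrArg (fun w => lor w (dirDeriv x₁ v z)) com
  have com₂ := congrArg (fun w => lor w (dirDeriv x₂ v z)) com
  -- derivatives of `f n`
  have V (x : E → E) : ∀ q ∈ Ω, dirDeriv x (fun q => f q • n q) q
      = dirDeriv x f q • n q + f q • dirDeriv x n q := fun q hq =>
    dirDeriv_smul (dA h.smooth_f hq) (dA h.smooth_n hq)
  have VV₁ : dirDeriv x₁ (dirDeriv x₁ fun q => f q • n q) z
      = dirDeriv x₁ (dirDeriv x₁ f) z • n z + (2 * dirDeriv x₁ f z) • dirDeriv x₁ n z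
        + f z • dirDeriv x₁ (dirDeriv x₁ n) z := by
    have cf := contDiffOn_dirDeriv h.isOpen h.smooth₁ h.smooth_f
    rw [dirDeriv_congr h.isOpen (V x₁) hz,
      dirDeriv_add ((dA cf hz).fun_smul (dA h.smooth_n hz))
        ((dA h.smooth_f hz).fun_smul (dA h.smooth_Dn₁ hz)),
      dirDeriv_smul (dA cf hz) (dA h.smooth_n hz),
      dirDeriv_smul (dA h.smooth_f hz) (dA h.smooth_Dn₁ hz)]
    module
  have VV₂ : dirDeriv x₂ (dirDeriv x₂ fun q => f q • n q) z
      = f z • dirDeriv x₂ (dirDeriv x₂ n) z := by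
    have V' : ∀ q ∈ Ω, dirDeriv x₂ (fun q => f q • n q) q = f q • dirDeriv x₂ n q :=
      fun q hq => by rw [V x₂ q hq, h.df₂ q hq, zero_smul, zero_add]
    rw [dirDeriv_congr h.isOpen V' hz,
      dirDeriv_smul (dA h.smooth_f hz) (dA h.smooth_Dn₂ hz), h.df₂ z hz, zero_smul, zero_add]
  have b₁ := h.bicons z hz _ (Set.mem_insert _ _)
  have b₂ := h.bicons z hz _ (Set.mem_insert_of_mem _ rfl)
  rw [VV₁, VV₂, V x₁ z hz, V x₂ z hz, h.df₂ z hz, D₁₁, D₂₂, n₁ z hz, n₂ z hz] at b₁ b₂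
  simp only [lor_sub_left, lor_add_left, lor_smul_left, h.n_e₁ z hz, h.n_e₂ z hz, u₁, u₂, o, o',
    a21 x₁, a11, a22, w₂] at com₁ com₂ b₁ b₂
  have t₁ := dtr x₁ z hz
  have t₂ := dtr x₂ z hz
  rw [h.df₂ z hz] at t₂
  have f₁ := h.df₁ z hz
  have t := tr z hz
  rw [smul_eq_mul] at t
  -- The `e₁`-part of the biconservative equation is `2 (D₁f) s₁₁ + f (div s)₁ = 0`. By Codazzi
  -- `(div s)₁ = D₁(s₁₁ + s₂₂) = -2 D₁f`, and `D₁f ≠ 0` can be cancelled. The `e₂`-part below is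
  -- similar, with `D₂f = 0`.
  have r₁ : s₁₁ z = f z := by
    refine mul_left_cancel₀ f₁ ?_
    linear_combination (1 / 2) * b₁ - (1 / 2) * f z * t₁ + (1 / 2) * f z * com₂
  have r₂ : s₁₂ z = 0 := by
    refine mul_left_cancel₀ f₁ ?_
    linear_combination (1 / 2) * b₂ - (1 / 2) * f z * t₂ - (1 / 2) * f z * com₁
  rw [n₁ z hz, n₂ z hz, r₂, r₁, show s₂₂ z = -(3 * f z) by linarith]
  simp

/-- The connection of the surface in the frame `x₁, x₂`. -/
theorem connection (h : IsBiconservativeFrame Ω v x₁ x₂ f n) (hz : z ∈ Ω) :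
    lor (dirDeriv x₁ (dirDeriv x₁ v) z) (dirDeriv x₂ v z) = 0 ∧
    dirDeriv x₂ (dirDeriv x₁ v) z
      = (-lor (dirDeriv x₂ (dirDeriv x₂ v) z) (dirDeriv x₁ v z)) • dirDeriv x₂ v z ∧
    dirDeriv x₁ (dirDeriv x₂ v) z = 0 ∧
    4 * f z * lor (dirDeriv x₂ (dirDeriv x₂ v) z) (dirDeriv x₁ v z) = 3 * dirDeriv x₁ f z := by
  have hf := h.smooth_f
  have dA : ∀ {F : Type} [NormedAddCommGroup F] [NormedSpace ℝ F] {W : E → F},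
      ContDiffOn ℝ ∞ W Ω → ∀ {q}, q ∈ Ω → DifferentiableAt ℝ W q := fun hW _ hq =>
    differentiableAt_of_contDiffOn h.isOpen hW hq
  have d₃ : ContDiffOn ℝ ∞ (fun q => -(3 * f q)) Ω := (contDiffOn_const.mul hf).neg
  have df₃ : dirDeriv x₁ (fun q => -(3 * f q)) z = -(3 * dirDeriv x₁ f z) := by
    have : (fun q => -(3 * f q)) = fun q => (-3 : ℝ) • f q := by ext q; simp
    rw [this, dirDeriv_smul (differentiableAt_const _) (dA hf hz), dirDeriv_const]
    simp
  have com := h.commutator hz h.smooth_n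
  rw [dirDeriv_congr h.isOpen (fun q hq => (h.shape_eq hq).2) hz,
    dirDeriv_congr h.isOpen (fun q hq => (h.shape_eq hq).1) hz,
    dirDeriv_smul (dA d₃ hz) (dA h.smooth_e₂ hz), dirDeriv_smul (dA hf hz) (dA h.smooth_e₁ hz),
    df₃, h.df₂ z hz, (h.shape_eq hz).1, (h.shape_eq hz).2] at com
  have comv := h.commutator hz h.smooth
  have u₁ := h.unit₁ z hz
  have u₂ := h.unit₂ z hz
  have o := h.orth z hz
  have o' := o
  rw [lor_comm] at o'
  have a21 := h.lor_De₂_e₁ hz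
  have a11 := h.lor_De₁_e₁ hz
  have a22 := h.lor_De₂_e₂ hz
  have fp := h.f_pos z hz
  have w₂ : lor (dirDeriv x₂ (dirDeriv x₁ v) z) (dirDeriv x₂ v z)
      = -lor (dirDeriv x₂ (dirDeriv x₂ v) z) (dirDeriv x₁ v z) := by
    rw [a21, neg_neg]
  have com₁ := congrArg (fun w => lor w (dirDeriv x₁ v z)) com
  have com₂ := congrArg (fun w => lor w (dirDeriv x₂ v z)) com
  simp only [lor_sub_left, lor_add_left, lor_smul_left, u₁, u₂, o, o', a21 x₁, a11, a22, w₂]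
    at com₁ com₂
  -- Codazzi for `diag(-f, 3f)`: the `e₁`-component is `(3f + f) a = 0`, where `4f` is the gap
  -- between the principal curvatures.
  have a0 : lor (dirDeriv x₁ (dirDeriv x₁ v) z) (dirDeriv x₂ v z) = 0 := by
    have : f z * lor (dirDeriv x₁ (dirDeriv x₁ v) z) (dirDeriv x₂ v z) = 0 := by
      linear_combination (1 / 4) * com₁
    exact (mul_eq_zero.1 this).resolve_left fp.ne'
  set w := lor (dirDeriv x₂ (dirDeriv x₂ v) z) (dirDeriv x₁ v z) with hw
  have hw3 : 4 * f z * w = 3 * dirDeriv x₁ f z := by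
    linear_combination com₂
  rw [a0, neg_zero, zero_smul, zero_add] at com comv
  have e12 : dirDeriv x₁ (dirDeriv x₂ v) z
      = dirDeriv x₂ (dirDeriv x₁ v) z + w • dirDeriv x₂ v z := by
    rw [← comv]; abel
  -- The vector identity is used in full, not only its tangential components. Commuting on `n`
  -- involves `3 D₁e₂ + D₂e₁`, commuting on `v` involves `D₁e₂ - D₂e₁`; eliminating `D₁e₂` leaves
  -- `4f D₂e₁` as a multiple of `e₂`, so the mixed second fundamental form vanishes too.
  have e21 : dirDeriv x₂ (dirDeriv x₁ v) z = (-w) • dirDeriv x₂ v z := by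
    have h4 : (4 * f z) • dirDeriv x₂ (dirDeriv x₁ v) z
        = (4 * f z) • ((-w) • dirDeriv x₂ v z) := by
      rw [e12] at com
      have : (4 * f z) • dirDeriv x₂ (dirDeriv x₁ v) z = (-(3 * dirDeriv x₁ f z)) • dirDeriv x₂ v z := by
        linear_combination (norm := module) -com
      rw [this, ← hw3]
      module
    exact smul_right_injective _ (by positivity : (4 * f z) ≠ 0) h4
  refine ⟨a0, e21, ?_, hw3⟩
  rw [e12, e21]
  module

/-- `∇̂_{x₂} ∇̂_{x₂} e₂ = -⟨∇̂_{x₂} e₂, ∇̂_{x₂} e₂⟩ e₂`. -/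
theorem deriv_accel (h : IsBiconservativeFrame Ω v x₁ x₂ f n) (hz : z ∈ Ω) :
    dirDeriv x₂ (dirDeriv x₂ (dirDeriv x₂ v)) z
      = (-lor (dirDeriv x₂ (dirDeriv x₂ v) z) (dirDeriv x₂ (dirDeriv x₂ v) z)) •
        dirDeriv x₂ v z := by
  have hf := h.smooth_f
  have dA : ∀ {F : Type} [NormedAddCommGroup F] [NormedSpace ℝ F] {W : E → F},
      ContDiffOn ℝ ∞ W Ω → ∀ {q}, q ∈ Ω → DifferentiableAt ℝ W q := fun hW _ hq =>
    differentiableAt_of_contDiffOn h.isOpen hW hq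
  have c₂₂ := contDiffOn_dirDeriv h.isOpen h.smooth₂ h.smooth_e₂
  have c₁₁ := contDiffOn_dirDeriv h.isOpen h.smooth₁ h.smooth_e₁
  set w : E → ℝ := fun q => lor (dirDeriv x₂ (dirDeriv x₂ v) q) (dirDeriv x₁ v q) with hw
  have cw : ContDiffOn ℝ ∞ w Ω := c₂₂.lor h.smooth_e₁
  have conn := fun {q} (hq : q ∈ Ω) => h.connection hq
  have cf₁ := contDiffOn_dirDeriv h.isOpen h.smooth₁ hf
  -- Commuting on `f` with `D₂f = 0` and `a = 0` gives `D₂D₁f = 0`; then `4fw = 3 D₁f` is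
  -- differentiated along `x₂`.
  have dw : dirDeriv x₂ w z = 0 := by
    have h1 : dirDeriv x₂ (fun q => (4 * f q) • w q) z
        = dirDeriv x₂ (fun q => (3 : ℝ) • dirDeriv x₁ f q) z :=
      dirDeriv_congr h.isOpen (fun q hq => (conn hq).2.2.2) hz
    have h2 : dirDeriv x₂ (fun q => 4 * f q) z = 0 := by
      have : (fun q => 4 * f q) = fun q => (4 : ℝ) • f q := rfl
      rw [this, dirDeriv_smul (differentiableAt_const _) (dA hf hz), dirDeriv_const, h.df₂ z hz]
      simp
    have h3 := h.commutator hz hf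
    rw [dirDeriv_congr h.isOpen (fun q hq => h.df₂ q hq) hz, dirDeriv_const, h.df₂ z hz,
      (conn hz).1] at h3
    have h4 : dirDeriv x₂ (dirDeriv x₁ f) z = 0 := by simpa using h3
    rw [dirDeriv_smul (dA (contDiffOn_const.mul hf) hz) (dA cw hz),
      dirDeriv_smul (differentiableAt_const _) (dA cf₁ hz), h2, h4, dirDeriv_const] at h1
    simpa [(h.f_pos z hz).ne'] using h1
  -- The mean curvature equation solved for `D₂e₂`. The term `2v` arises because `⟨Dᵢeᵢ, v⟩ = -⟨eᵢ,
  -- eᵢ⟩ = -1` for both frame vectors and `v` is timelike.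
  have accel : ∀ q ∈ Ω, dirDeriv x₂ (dirDeriv x₂ v) q
      = w q • dirDeriv x₁ v q + (2 : ℝ) • (f q • n q) + (2 : ℝ) • v q
        - dirDeriv x₁ (dirDeriv x₁ v) q := by
    intro q hq
    have m := h.mean q hq
    have hv : lor (dirDeriv x₁ (dirDeriv x₁ v) q + dirDeriv x₂ (dirDeriv x₂ v) q) (v q) = -2 := by
      rw [lor_add_left, h.lor_De₁_v hq, h.lor_De₂_v hq, h.unit₁ q hq, h.unit₂ q hq]
      norm_num
    have h1 : lor (dirDeriv x₁ (dirDeriv x₁ v) q + dirDeriv x₂ (dirDeriv x₂ v) q)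
        (dirDeriv x₁ v q) = w q := by
      rw [lor_add_left, h.lor_De₁_e₁ hq, zero_add]
    have h2 : lor (dirDeriv x₁ (dirDeriv x₁ v) q + dirDeriv x₂ (dirDeriv x₂ v) q)
        (dirDeriv x₂ v q) = 0 := by
      rw [lor_add_left, h.lor_De₂_e₂ hq, add_zero, (conn hq).1]
    rw [frameNormal, hv, h1, h2] at m
    linear_combination (norm := module) m
  -- `D₁e₁` may have an uncontrolled normal component; commuting the derivatives on `e₁` avoids it,
  -- since `D₂e₁ = -w e₂` and `D₁e₂ = 0`.
  have d11 : dirDeriv x₂ (dirDeriv x₁ (dirDeriv x₁ v)) z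
      = (w z ^ 2 - dirDeriv x₁ w z) • dirDeriv x₂ v z := by
    have com := h.commutator hz h.smooth_e₁
    rw [dirDeriv_congr h.isOpen (fun q hq => (conn hq).2.1) hz,
      dirDeriv_smul (dA cw.neg hz) (dA h.smooth_e₂ hz), (conn hz).2.2.1, (conn hz).1,
      (conn hz).2.1] at com
    have hn : dirDeriv x₁ (fun q => -w q) z = -dirDeriv x₁ w z := by
      simp [dirDeriv]
    change dirDeriv x₁ (fun q => -w q) z • _ + _ - _ = _ + w z • (-w z) • _ at com
    rw [hn] at com
    linear_combination (norm := module) -com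
  obtain ⟨c, hc⟩ : ∃ c : ℝ, dirDeriv x₂ (dirDeriv x₂ (dirDeriv x₂ v)) z = c • dirDeriv x₂ v z := by
    have s₁ := (dA cw hz).fun_smul (dA h.smooth_e₁ hz)
    have s₀ := (dA hf hz).fun_smul (dA h.smooth_n hz)
    have s₂ := s₀.fun_const_smul (2 : ℝ)
    have s₃ := (dA h.smooth hz).fun_const_smul (2 : ℝ)
    have e := dirDeriv_congr (x := x₂) h.isOpen accel hz
    rw [dirDeriv_sub ((s₁.fun_add s₂).fun_add s₃) (dA c₁₁ hz), dirDeriv_add (s₁.fun_add s₂) s₃,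
      dirDeriv_add s₁ s₂, dirDeriv_smul (dA cw hz) (dA h.smooth_e₁ hz),
      dirDeriv_smul (differentiableAt_const _) s₀,
      dirDeriv_smul (dA hf hz) (dA h.smooth_n hz),
      dirDeriv_smul (differentiableAt_const _) (dA h.smooth hz), dw, h.df₂ z hz, d11,
      (conn hz).2.1, (h.shape_eq hz).2, dirDeriv_const] at e
    refine ⟨-w z * w z - 6 * f z ^ 2 + 2 - (w z ^ 2 - dirDeriv x₁ w z), e.trans ?_⟩
    change _ + w z • (-w z) • _ + _ + _ - _ = _
    module
  -- Differentiating `⟨D₂e₂, e₂⟩ = 0` identifies the factor `c` without evaluating the expression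
  -- found for it.
  have hl := dirDeriv_lor_of_const (x := x₂) h.isOpen c₂₂ h.smooth_e₂
    (fun q hq => h.lor_De₂_e₂ hq x₂) hz
  rw [hc, lor_smul_left, h.unit₂ z hz, mul_one] at hl
  rw [hc, hl]

end IsBiconservativeFrame

end LocalFrame

/-! ### The curvature of `ℍ⁴` -/

section HypCurvature

variable {q x y z : Mink}

theorem fderiv_hypProj (x r w : Mink) :
    fderiv ℝ (fun r => hypProj r x) r w = lor x w • r + lor x r • w := by
  have h : HasFDerivAt (fun r : Mink => x + lorL x r • r) _ r :=
    (((lorL x).hasFDerivAt (x := r)).smul (hasFDerivAt_id r)).const_add x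
  have h2 := h.fderiv
  change fderiv ℝ (fun r => hypProj r x) r = _ at h2
  rw [h2]
  simp [lorL_apply, add_comm]

theorem hypProj_self (hq : lor q q = -1) (c : ℝ) : hypProj q (c • q) = 0 := by
  rw [hypProj, lor_smul_left, hq]
  module

theorem hypProj_add (q v w : Mink) : hypProj q (v + w) = hypProj q v + hypProj q w := by
  simp only [hypProj, lor_add_left]
  module

theorem hypProj_smul (q : Mink) (c : ℝ) (v : Mink) : hypProj q (c • v) = c • hypProj q v := by
  simp only [hypProj, lor_smul_left]
  module

theorem hypProj_of_orthogonal (hx : lor x q = 0) : hypProj q x = x := by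
  rw [hypProj, hx, zero_smul, add_zero]

/-- The inner covariant derivative is `A + ⟨A, r⟩ r`, and `A q = ⟨z, y⟩ q`. Differentiating along
`x` gives `⟨z, y⟩ x + ⟨z, x⟩ y` from `A`, while the second summand contributes `-⟨z, y⟩ x` and a
multiple of `q`, which the projection kills. -/
theorem hypNabla_hypNabla (hq : lor q q = -1) (hx : lor x q = 0) (hy : lor y q = 0)
    (hz : lor z q = 0) :
    hypNabla (fun r => hypProj r x)
      (hypNabla (fun r => hypProj r y) (fun r => hypProj r z)) q = lor z x • y := by
  set A : Mink → Mink := fun r => lor z (hypProj r y) • r + lor z r • hypProj r y with hA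
  have hN : hypNabla (fun r => hypProj r y) (fun r => hypProj r z)
      = fun r => A r + lor (A r) r • r := by
    funext r
    rw [hypNabla, fderiv_hypProj]
    rfl
  have dY : DifferentiableAt ℝ (fun r => hypProj r y) q :=
    (((lorL y).differentiableAt (x := q)).smul differentiableAt_id).const_add y
  have dc : DifferentiableAt ℝ (fun r => lor z (hypProj r y)) q := (differentiableAt_const z).lor dY
  have dl : DifferentiableAt ℝ (fun r => lor z r) q := (differentiableAt_const z).lor differentiableAt_id
  have d1 : DifferentiableAt ℝ (fun r => lor z (hypProj r y) • r) q := dc.fun_smul differentiableAt_id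
  have d2 : DifferentiableAt ℝ (fun r => lor z r • hypProj r y) q := dl.fun_smul dY
  have dA : DifferentiableAt ℝ A q := d1.fun_add d2
  have dAl : DifferentiableAt ℝ (fun r => lor (A r) r) q := dA.lor differentiableAt_id
  have d3 : DifferentiableAt ℝ (fun r => lor (A r) r • r) q := dAl.fun_smul differentiableAt_id
  have fz : fderiv ℝ (fun r => lor z r) q x = lor z x := by
    rw [fderiv_lor (V := fun _ => z) (W := fun r => r) (differentiableAt_const z) differentiableAt_id]
    simp
  have fc : fderiv ℝ (fun r => lor z (hypProj r y)) q x = 0 := by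
    rw [fderiv_lor (V := fun _ => z) (differentiableAt_const z) dY, fderiv_hypProj]
    simp [hy, lor_smul_right, hz]
  have Aq : A q = lor z y • q := by
    simp only [hA]
    rw [hypProj_of_orthogonal hy, hz]
    simp
  have fA : fderiv ℝ A q x = lor z y • x + lor z x • y := by
    rw [hA, fderiv_fun_add d1 d2, fderiv_fun_smul dc differentiableAt_fun_id, fderiv_fun_smul dl dY]
    simp [fz, fc, hz, hypProj_of_orthogonal hy]
  rw [hypNabla]
  simp only [hypProj_of_orthogonal hx]
  rw [hN, fderiv_fun_add dA d3, fderiv_fun_smul dAl differentiableAt_fun_id]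
  simp only [add_apply, smul_apply,
    ContinuousLinearMap.smulRight_apply, fderiv_fun_id, ContinuousLinearMap.id_apply, fA]
  rw [Aq, lor_smul_left, hq, hypProj_add, hypProj_add, hypProj_add, hypProj_self hq, hypProj_smul,
    hypProj_smul, hypProj_smul, hypProj_of_orthogonal hx, hypProj_of_orthogonal hy]
  module

/-- `ℍ⁴` has constant curvature `-1`. -/
theorem hypCurvature_eq (hq : lor q q = -1) (hx : lor x q = 0) (hy : lor y q = 0)
    (hz : lor z q = 0) : hypCurvature q x y z = lor x z • y - lor y z • x := by
  -- At `q` each projected field has derivative `⟨x, y⟩ q` along the other, so the two terms of the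
  -- bracket cancel.
  have hb : VectorField.lieBracket ℝ (fun r => hypProj r x) (fun r => hypProj r y) q = 0 := by
    rw [VectorField.lieBracket, fderiv_hypProj, fderiv_hypProj,
      hypProj_of_orthogonal hx, hypProj_of_orthogonal hy, hx, hy, lor_comm x y]
    simp
  simp only [hypCurvature]
  rw [hypNabla_hypNabla hq hx hy hz, hypNabla_hypNabla hq hy hx hz, hypNabla, hb, map_zero,
    lor_comm z, lor_comm z]
  simp [hypProj]

end HypCurvature

/-! ### Traces and projections in an orthonormal basis of the tangent plane -/

section Pointwise

variable {M : Type*} [TopologicalSpace M] [ChartedSpace (EuclideanSpace ℝ (Fin 2)) M]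

/-- `u₁, u₂` is an orthonormal basis of `T_p M`, and `T_p M ⊆ T ℍ⁴`. -/
structure IsOrthonormalPair (Φ : M → Mink) (p : M) (u₁ u₂ : TangentSpace (𝓡 2) p) : Prop where
  hyp : lor (Φ p) (Φ p) = -1
  tangent : ∀ x, lor (flatDeriv Φ p x) (Φ p) = 0
  unit₁ : indMetric Φ p u₁ u₁ = 1
  unit₂ : indMetric Φ p u₂ u₂ = 1
  orth : indMetric Φ p u₁ u₂ = 0

theorem exists_coord (p : M) (u : TangentSpace (𝓡 2) p) :
    ∃ c : Fin 2 → ℝ, u = ∑ i, c i • coordVec p i := by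
  refine ⟨fun i => (show EuclideanSpace ℝ (Fin 2) from u) i, ?_⟩
  change (show EuclideanSpace ℝ (Fin 2) from u) = ∑ i, _ • (EuclideanSpace.single i (1 : ℝ))
  ext j
  fin_cases j <;> simp

theorem indMetric_comm (Φ : M → Mink) (p : M) (x y : TangentSpace (𝓡 2) p) :
    indMetric Φ p x y = indMetric Φ p y x := lor_comm _ _

theorem indMetric_sum (Φ : M → Mink) (p : M) (c d : Fin 2 → ℝ) :
    indMetric Φ p (∑ i, c i • coordVec p i) (∑ j, d j • coordVec p j)
      = ∑ i, ∑ j, c i * d j * gram Φ p i j := by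
  simp only [indMetric, gram, Matrix.of_apply, Fin.sum_univ_two, map_add, map_smul, lor_add_left,
    lor_add_right, lor_smul_left, lor_smul_right]
  ring

namespace IsOrthonormalPair

variable {Φ : M → Mink} {p : M} {u₁ u₂ : TangentSpace (𝓡 2) p}

/-- The rows of `P` are the coordinates of `u₁, u₂`. Orthonormality is `P G Pᵀ = 1`, equivalently
`G⁻¹ = Pᵀ P`, which turns contractions with `G⁻¹` into sums over the pair. -/
theorem exists_gram_inv (h : IsOrthonormalPair Φ p u₁ u₂) :
    ∃ P : Matrix (Fin 2) (Fin 2) ℝ, gram Φ p * (gram Φ p)⁻¹ = 1 ∧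
      (∀ i j, (gram Φ p)⁻¹ i j = P 0 i * P 0 j + P 1 i * P 1 j) ∧
      u₁ = ∑ i, P 0 i • coordVec p i ∧ u₂ = ∑ i, P 1 i • coordVec p i := by
  obtain ⟨c, hc⟩ := exists_coord p u₁
  obtain ⟨d, hd⟩ := exists_coord p u₂
  have h1 := h.unit₁
  have h2 := h.unit₂
  have h3 := h.orth
  have h4 := h.orth
  rw [indMetric_comm] at h4
  rw [hc, indMetric_sum] at h1
  rw [hd, indMetric_sum] at h2
  rw [hc, hd, indMetric_sum] at h3 h4
  have hP : (!![c 0, c 1; d 0, d 1] : Matrix (Fin 2) (Fin 2) ℝ)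
      * (gram Φ p * (!![c 0, c 1; d 0, d 1] : Matrix (Fin 2) (Fin 2) ℝ).transpose) = 1 := by
    simp only [Fin.sum_univ_two] at h1 h2 h3 h4
    ext i j
    fin_cases i <;> fin_cases j <;>
      simp [Matrix.mul_apply, Fin.sum_univ_two] <;> linarith
  have hG : gram Φ p * ((!![c 0, c 1; d 0, d 1] : Matrix (Fin 2) (Fin 2) ℝ).transpose
      * (!![c 0, c 1; d 0, d 1] : Matrix (Fin 2) (Fin 2) ℝ)) = 1 := by
    rw [← Matrix.mul_assoc]
    exact mul_eq_one_comm.1 hP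
  have hI := Matrix.inv_eq_right_inv hG
  refine ⟨!![c 0, c 1; d 0, d 1], by rw [hI, hG], fun i j => ?_, ?_, ?_⟩
  · rw [hI]
    simp [Matrix.mul_apply, Fin.sum_univ_two]
  · rw [hc]
    simp [Fin.sum_univ_two]
  · rw [hd]
    simp [Fin.sum_univ_two]

theorem metricTrace_eq (h : IsOrthonormalPair Φ p u₁ u₂)
    (b : TangentSpace (𝓡 2) p →ₗ[ℝ] TangentSpace (𝓡 2) p →ₗ[ℝ] Mink) :
    metricTrace Φ p (fun x y => b x y) = b u₁ u₁ + b u₂ u₂ := by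
  obtain ⟨P, -, hG, h₁, h₂⟩ := h.exists_gram_inv
  simp only [metricTrace, hG]
  rw [h₁, h₂]
  simp only [Fin.sum_univ_two, map_add, map_smul, LinearMap.add_apply, LinearMap.smul_apply]
  module

theorem sharp_eq (h : IsOrthonormalPair Φ p u₁ u₂) (a : TangentSpace (𝓡 2) p →ₗ[ℝ] ℝ) :
    sharp Φ p (fun x => a x) = a u₁ • u₁ + a u₂ • u₂ := by
  obtain ⟨P, -, hG, h₁, h₂⟩ := h.exists_gram_inv
  simp only [sharp, hG]
  rw [h₁, h₂]
  simp only [Fin.sum_univ_two, map_add, map_smul, smul_eq_mul]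
  module

theorem tangentPart_eq (h : IsOrthonormalPair Φ p u₁ u₂) (w : Mink) :
    tangentPart Φ p w = lor w (flatDeriv Φ p u₁) • u₁ + lor w (flatDeriv Φ p u₂) • u₂ :=
  h.sharp_eq ((lorL w).toLinearMap ∘ₗ (flatDeriv Φ p).toLinearMap)

/-- Invertibility of the Gram matrix. Together with `tangentPart_eq` it shows that the pair spans
`T_p M`. -/
theorem tangentPart_flatDeriv (h : IsOrthonormalPair Φ p u₁ u₂) (u : TangentSpace (𝓡 2) p) :
    tangentPart Φ p (flatDeriv Φ p u) = u := by
  obtain ⟨P, hG, -, -, -⟩ := h.exists_gram_inv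
  obtain ⟨c, hc⟩ := exists_coord p u
  have hG' : ∀ i j, gram Φ p i 0 * (gram Φ p)⁻¹ 0 j + gram Φ p i 1 * (gram Φ p)⁻¹ 1 j
      = (1 : Matrix (Fin 2) (Fin 2) ℝ) i j := fun i j => by
    rw [← hG, Matrix.mul_apply, Fin.sum_univ_two]
  have g00 := hG' 0 0
  have g01 := hG' 0 1
  have g10 := hG' 1 0
  have g11 := hG' 1 1
  have hl : ∀ i, lor (flatDeriv Φ p u) (flatDeriv Φ p (coordVec p i))
      = c 0 * gram Φ p 0 i + c 1 * gram Φ p 1 i := fun i => by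
    rw [hc]
    simp [Fin.sum_univ_two, map_add, map_smul, lor_add_left, lor_smul_left, gram, indMetric]
  simp only [tangentPart, sharp, hl]
  rw [hc]
  simp only [Fin.sum_univ_two] at g00 g01 g10 g11 ⊢
  simp only [Matrix.one_apply_eq, ne_eq, zero_ne_one, one_ne_zero, not_false_eq_true,
    Matrix.one_apply_ne] at g00 g01 g10 g11
  have e0 : (gram Φ p)⁻¹ 0 0 * (c 0 * gram Φ p 0 0 + c 1 * gram Φ p 1 0)
      + (gram Φ p)⁻¹ 1 0 * (c 0 * gram Φ p 0 1 + c 1 * gram Φ p 1 1) = c 0 := by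
    linear_combination c 0 * g00 + c 1 * g10
  have e1 : (gram Φ p)⁻¹ 0 1 * (c 0 * gram Φ p 0 0 + c 1 * gram Φ p 1 0)
      + (gram Φ p)⁻¹ 1 1 * (c 0 * gram Φ p 0 1 + c 1 * gram Φ p 1 1) = c 1 := by
    linear_combination c 0 * g01 + c 1 * g11
  linear_combination (norm := module) e0 • coordVec p 0 + e1 • coordVec p 1

theorem normalPart_eq (h : IsOrthonormalPair Φ p u₁ u₂) (w : Mink) :
    normalPart Φ p w = frameNormal (Φ p) (flatDeriv Φ p u₁) (flatDeriv Φ p u₂) w := by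
  rw [normalPart, h.tangentPart_eq, map_add, map_smul, map_smul]
  rfl

theorem lor_normalPart_self (h : IsOrthonormalPair Φ p u₁ u₂) (w : Mink) :
    lor (normalPart Φ p w) (Φ p) = 0 := by
  rw [h.normalPart_eq, frameNormal]
  simp only [lor_add_left, lor_sub_left, lor_smul_left, h.hyp, h.tangent]
  ring

theorem lor_normalPart_flatDeriv (h : IsOrthonormalPair Φ p u₁ u₂) (w : Mink)
    (u : TangentSpace (𝓡 2) p) : lor (normalPart Φ p w) (flatDeriv Φ p u) = 0 := by
  have a1 := h.unit₁
  have a2 := h.unit₂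
  have a3 := h.orth
  have a4 := h.orth
  rw [indMetric_comm] at a4
  simp only [indMetric] at a1 a2 a3 a4
  have hu := h.tangentPart_flatDeriv u
  rw [h.tangentPart_eq] at hu
  rw [← hu, h.normalPart_eq, frameNormal]
  simp only [map_add, map_smul, lor_add_left, lor_sub_left, lor_smul_left, lor_add_right,
    lor_smul_right, lor_comm (Φ p) (flatDeriv Φ p _), h.tangent, a1, a2, a3, a4]
  ring

theorem tangentPart_add (h : IsOrthonormalPair Φ p u₁ u₂) (v w : Mink) :
    tangentPart Φ p (v + w) = tangentPart Φ p v + tangentPart Φ p w := by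
  simp only [h.tangentPart_eq, lor_add_left]
  module

theorem tangentPart_hypProj (h : IsOrthonormalPair Φ p u₁ u₂) (w : Mink) :
    tangentPart Φ p (hypProj (Φ p) w) = tangentPart Φ p w := by
  simp only [h.tangentPart_eq, hypProj, lor_add_left, lor_smul_left,
    lor_comm (Φ p) (flatDeriv Φ p _), h.tangent, mul_zero, add_zero]

theorem normalPart_add (h : IsOrthonormalPair Φ p u₁ u₂) (v w : Mink) :
    normalPart Φ p (v + w) = normalPart Φ p v + normalPart Φ p w := by
  simp only [normalPart, h.tangentPart_add, hypProj_add, map_add]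
  abel

theorem normalPart_hypProj (h : IsOrthonormalPair Φ p u₁ u₂) (w : Mink) :
    normalPart Φ p (hypProj (Φ p) w) = normalPart Φ p w := by
  rw [normalPart, normalPart, h.tangentPart_hypProj]
  congr 1
  rw [hypProj, hypProj, lor_add_left, lor_smul_left, h.hyp]
  module

theorem normalPart_sub (h : IsOrthonormalPair Φ p u₁ u₂) (v w : Mink) :
    normalPart Φ p (v - w) = normalPart Φ p v - normalPart Φ p w := by
  simp only [h.normalPart_eq, frameNormal, lor_sub_left]
  module

theorem normalPart_smul (h : IsOrthonormalPair Φ p u₁ u₂) (c : ℝ) (w : Mink) :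
    normalPart Φ p (c • w) = c • normalPart Φ p w := by
  simp only [h.normalPart_eq, frameNormal, lor_smul_left]
  module

theorem tangentPart_smul (h : IsOrthonormalPair Φ p u₁ u₂) (c : ℝ) (w : Mink) :
    tangentPart Φ p (c • w) = c • tangentPart Φ p w := by
  simp only [h.tangentPart_eq, lor_smul_left]
  module

theorem normalPart_flatDeriv (h : IsOrthonormalPair Φ p u₁ u₂) (u : TangentSpace (𝓡 2) p) :
    normalPart Φ p (flatDeriv Φ p u) = 0 := by
  rw [normalPart, h.tangentPart_flatDeriv, hypProj_of_orthogonal (h.tangent u), sub_self]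

theorem lor_eq_zero_of_tangentPart (h : IsOrthonormalPair Φ p u₁ u₂) {w : Mink}
    (hw : tangentPart Φ p w = 0) (u : TangentSpace (𝓡 2) p) : lor w (flatDeriv Φ p u) = 0 := by
  have h1 := h.lor_normalPart_flatDeriv w u
  rw [normalPart, hw, map_zero, sub_zero, hypProj, lor_add_left, lor_smul_left,
    lor_comm (Φ p) (flatDeriv Φ p _), h.tangent, mul_zero, add_zero] at h1
  exact h1

end IsOrthonormalPair

end Pointwise

/-! ### Chart representations -/

section Chart

variable {M : Type*} [TopologicalSpace M] [ChartedSpace (EuclideanSpace ℝ (Fin 2)) M]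

/-- The representation of `V` in the chart at `p₀`. -/
def chartRep {F : Type*} (p₀ : M) (V : M → F) (z : EuclideanSpace ℝ (Fin 2)) : F :=
  V ((extChartAt (𝓡 2) p₀).symm z)

/-- The differential at `q` of the chart at `p₀`. -/
def chartDiff (p₀ q : M) : TangentSpace (𝓡 2) q →L[ℝ] EuclideanSpace ℝ (Fin 2) :=
  mfderiv (𝓡 2) 𝓘(ℝ, EuclideanSpace ℝ (Fin 2)) (extChartAt (𝓡 2) p₀) q

/-- The representation of a vector field in the chart at `p₀`. -/
def fieldRep (p₀ : M) (Y : (q : M) → TangentSpace (𝓡 2) q) (z : EuclideanSpace ℝ (Fin 2)) :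
    EuclideanSpace ℝ (Fin 2) :=
  chartDiff p₀ ((extChartAt (𝓡 2) p₀).symm z) (Y ((extChartAt (𝓡 2) p₀).symm z))

variable {p₀ q : M}

theorem chartRep_extChartAt {F : Type*} (hq : q ∈ (extChartAt (𝓡 2) p₀).source) (V : M → F) :
    chartRep p₀ V (extChartAt (𝓡 2) p₀ q) = V q := by
  rw [chartRep, (extChartAt (𝓡 2) p₀).left_inv hq]

theorem fieldRep_extChartAt (hq : q ∈ (extChartAt (𝓡 2) p₀).source)
    (Y : (q : M) → TangentSpace (𝓡 2) q) :
    fieldRep p₀ Y (extChartAt (𝓡 2) p₀ q) = chartDiff p₀ q (Y q) := by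
  rw [fieldRep, (extChartAt (𝓡 2) p₀).left_inv hq]

theorem eventuallyEq_chartRep_comp {F : Type*} (hq : q ∈ (extChartAt (𝓡 2) p₀).source) (V : M → F) :
    V =ᶠ[nhds q] chartRep p₀ V ∘ extChartAt (𝓡 2) p₀ := by
  filter_upwards [(isOpen_extChartAt_source (I := 𝓡 2) p₀).mem_nhds hq] with r hr
  exact (chartRep_extChartAt hr V).symm

theorem extChartAt_target_mem_nhds_image (hq : q ∈ (extChartAt (𝓡 2) p₀).source) :
    (extChartAt (𝓡 2) p₀).target ∈ nhds (extChartAt (𝓡 2) p₀ q) :=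
  (isOpen_extChartAt_target (I := 𝓡 2) p₀).mem_nhds ((extChartAt (𝓡 2) p₀).map_source hq)

variable [IsManifold (𝓡 2) ∞ M] {F : Type*} [NormedAddCommGroup F] [NormedSpace ℝ F]

theorem contMDiffAt_extChartAt_of_mem (hq : q ∈ (extChartAt (𝓡 2) p₀).source) :
    ContMDiffAt (𝓡 2) 𝓘(ℝ, EuclideanSpace ℝ (Fin 2)) ∞ (extChartAt (𝓡 2) p₀) q :=
  contMDiffAt_extChartAt' (by simpa using hq)

theorem contMDiffAt_extChartAt_symm (hq : q ∈ (extChartAt (𝓡 2) p₀).source) :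
    ContMDiffAt 𝓘(ℝ, EuclideanSpace ℝ (Fin 2)) (𝓡 2) ∞ (extChartAt (𝓡 2) p₀).symm
      (extChartAt (𝓡 2) p₀ q) :=
  (contMDiffOn_extChartAt_symm p₀).contMDiffAt (extChartAt_target_mem_nhds_image hq)

theorem contDiffAt_chartRep (hq : q ∈ (extChartAt (𝓡 2) p₀).source) {V : M → F}
    (hV : ContMDiffAt (𝓡 2) 𝓘(ℝ, F) ∞ V q) :
    ContDiffAt ℝ ∞ (chartRep p₀ V) (extChartAt (𝓡 2) p₀ q) := by
  rw [← contMDiffAt_iff_contDiffAt]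
  refine ContMDiffAt.comp (extChartAt (𝓡 2) p₀ q) (g := V) ?_ (contMDiffAt_extChartAt_symm hq)
  rwa [(extChartAt (𝓡 2) p₀).left_inv hq]

theorem contMDiffAt_of_chartRep (hq : q ∈ (extChartAt (𝓡 2) p₀).source) {V : M → F}
    (hV : ContDiffAt ℝ ∞ (chartRep p₀ V) (extChartAt (𝓡 2) p₀ q)) :
    ContMDiffAt (𝓡 2) 𝓘(ℝ, F) ∞ V q :=
  (hV.contMDiffAt.comp q (contMDiffAt_extChartAt_of_mem hq)).congr_of_eventuallyEq
    (eventuallyEq_chartRep_comp hq V)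

theorem mfderiv_eq_fderiv_chartRep (hq : q ∈ (extChartAt (𝓡 2) p₀).source) {V : M → F}
    (hV : MDifferentiableAt (𝓡 2) 𝓘(ℝ, F) V q) (x : TangentSpace (𝓡 2) q) :
    mfderiv (𝓡 2) 𝓘(ℝ, F) V q x
      = fderiv ℝ (chartRep p₀ V) (extChartAt (𝓡 2) p₀ q) (chartDiff p₀ q x) := by
  have h1 := (contMDiffAt_extChartAt_of_mem hq).mdifferentiableAt (by simp)
  have h2 : MDifferentiableAt 𝓘(ℝ, EuclideanSpace ℝ (Fin 2)) 𝓘(ℝ, F) (chartRep p₀ V)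
      (extChartAt (𝓡 2) p₀ q) := by
    refine MDifferentiableAt.comp (extChartAt (𝓡 2) p₀ q) (g := V) ?_
      ((contMDiffAt_extChartAt_symm hq).mdifferentiableAt (by simp))
    rwa [(extChartAt (𝓡 2) p₀).left_inv hq]
  rw [(eventuallyEq_chartRep_comp hq V).mfderiv_eq, mfderiv_comp q h2 h1, mfderiv_eq_fderiv]
  rfl

theorem chartDiff_isInvertible (hq : q ∈ (extChartAt (𝓡 2) p₀).source) :
    (chartDiff p₀ q).IsInvertible :=
  isInvertible_mfderiv_extChartAt hq

/-- The differential of the chart at `p₀` is the tangent bundle trivialization at `p₀`, so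
smoothness of the section is smoothness of its chart components. -/
theorem contDiffAt_fieldRep (hq : q ∈ (extChartAt (𝓡 2) p₀).source)
    {Y : (q : M) → TangentSpace (𝓡 2) q}
    (hY : ContMDiffAt (𝓡 2) (𝓡 2).tangent ∞
      (fun r => (⟨r, Y r⟩ : TangentBundle (𝓡 2) M)) q) :
    ContDiffAt ℝ ∞ (fieldRep p₀ Y) (extChartAt (𝓡 2) p₀ q) := by
  have hq' : q ∈ (chartAt (EuclideanSpace ℝ (Fin 2)) p₀).source := by simpa using hq
  have h1 := ((trivializationAt (EuclideanSpace ℝ (Fin 2)) (TangentSpace (𝓡 2))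
    p₀).contMDiffAt_section_iff (IB := 𝓡 2) (n := ∞) (s := Y) (by simpa using hq)).1 hY
  have h2 := contDiffAt_chartRep hq h1
  refine h2.congr_of_eventuallyEq ?_
  filter_upwards [extChartAt_target_mem_nhds_image hq] with z hz
  have hz' := (extChartAt (𝓡 2) p₀).map_target hz
  have h3 := TangentBundle.continuousLinearMapAt_trivializationAt (I := 𝓡 2) (x₀ := p₀)
    (x := (extChartAt (𝓡 2) p₀).symm z) (by simpa using hz')
  simp only [fieldRep, chartRep, chartDiff]
  rw [← h3]
  rw [Bundle.Trivialization.continuousLinearMapAt_apply,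
    Bundle.Trivialization.coe_linearMapAt_of_mem _ (by simpa using hz')]

variable {V : M → Mink}

theorem flatDeriv_eq_fderiv_chartRep (hq : q ∈ (extChartAt (𝓡 2) p₀).source)
    (hV : MDifferentiableAt (𝓡 2) 𝓘(ℝ, Mink) V q) (x : TangentSpace (𝓡 2) q) :
    flatDeriv V q x
      = fderiv ℝ (chartRep p₀ V) (extChartAt (𝓡 2) p₀ q) (chartDiff p₀ q x) :=
  mfderiv_eq_fderiv_chartRep hq hV x

/-- The dictionary between the surface and the vector space calculus. It holds on the whole chart
target, so it can be iterated. -/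
theorem chartRep_flatDeriv (hV : ContMDiff (𝓡 2) 𝓘(ℝ, Mink) ∞ V)
    (Y : (q : M) → TangentSpace (𝓡 2) q) {z : EuclideanSpace ℝ (Fin 2)}
    (hz : z ∈ (extChartAt (𝓡 2) p₀).target) :
    chartRep p₀ (fun q => flatDeriv V q (Y q)) z = dirDeriv (fieldRep p₀ Y) (chartRep p₀ V) z := by
  rw [chartRep, flatDeriv_eq_fderiv_chartRep ((extChartAt (𝓡 2) p₀).map_target hz)
    ((hV _).mdifferentiableAt (by simp)), (extChartAt (𝓡 2) p₀).right_inv hz]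
  rfl

theorem contMDiffAt_flatDeriv_apply (hV : ContMDiff (𝓡 2) 𝓘(ℝ, Mink) ∞ V)
    {Y : (q : M) → TangentSpace (𝓡 2) q}
    (hY : ContMDiffAt (𝓡 2) (𝓡 2).tangent ∞
      (fun r => (⟨r, Y r⟩ : TangentBundle (𝓡 2) M)) q) :
    ContMDiffAt (𝓡 2) 𝓘(ℝ, Mink) ∞ (fun q => flatDeriv V q (Y q)) q := by
  have hq := mem_extChartAt_source (I := 𝓡 2) q
  refine contMDiffAt_of_chartRep hq ?_
  have h1 : ContDiffAt ℝ ∞ (dirDeriv (fieldRep q Y) (chartRep q V)) (extChartAt (𝓡 2) q q) :=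
    ((contDiffAt_chartRep hq (hV q)).fderiv_right (by simp)).clm_apply (contDiffAt_fieldRep hq hY)
  refine h1.congr_of_eventuallyEq ?_
  filter_upwards [extChartAt_target_mem_nhds_image hq] with z hz
  exact chartRep_flatDeriv hV Y hz

/-- The second flat derivative in terms of the chart at `p₀`. -/
theorem flatDeriv_flatDeriv (hq : q ∈ (extChartAt (𝓡 2) p₀).source)
    (hV : ContMDiff (𝓡 2) 𝓘(ℝ, Mink) ∞ V) {Y : (q : M) → TangentSpace (𝓡 2) q}
    (hY : ContMDiffAt (𝓡 2) (𝓡 2).tangent ∞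
      (fun r => (⟨r, Y r⟩ : TangentBundle (𝓡 2) M)) q) (x : TangentSpace (𝓡 2) q) :
    flatDeriv (fun q => flatDeriv V q (Y q)) q x
      = fderiv ℝ (fderiv ℝ (chartRep p₀ V)) (extChartAt (𝓡 2) p₀ q) (chartDiff p₀ q x)
          (chartDiff p₀ q (Y q))
        + fderiv ℝ (chartRep p₀ V) (extChartAt (𝓡 2) p₀ q)
          (fderiv ℝ (fieldRep p₀ Y) (extChartAt (𝓡 2) p₀ q) (chartDiff p₀ q x)) := by
  have h1 : chartRep p₀ (fun q => flatDeriv V q (Y q))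
      =ᶠ[nhds (extChartAt (𝓡 2) p₀ q)] dirDeriv (fieldRep p₀ Y) (chartRep p₀ V) := by
    filter_upwards [extChartAt_target_mem_nhds_image hq] with z hz
    exact chartRep_flatDeriv hV Y hz
  have h2 := (contDiffAt_fieldRep hq hY).differentiableAt (by simp)
  have h3 := ((contDiffAt_chartRep hq (hV q)).fderiv_right (m := ∞) (by simp)).differentiableAt
    (by simp)
  rw [flatDeriv_eq_fderiv_chartRep hq
    ((contMDiffAt_flatDeriv_apply hV hY).mdifferentiableAt (by simp)), h1.fderiv_eq,
    ← fieldRep_extChartAt hq]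
  exact dirDeriv_dirDeriv (x := fun _ => chartDiff p₀ q x) h2 h3

theorem contMDiffAt_extendVec {p : M} (y : TangentSpace (𝓡 2) p) :
    ContMDiffAt (𝓡 2) (𝓡 2).tangent ∞
      (fun r => (⟨r, extendVec y r⟩ : TangentBundle (𝓡 2) M)) p :=
  FiberBundle.contMDiffAt_extend (𝓡 2) (EuclideanSpace ℝ (Fin 2)) y

theorem extendVec_self {p : M} (y : TangentSpace (𝓡 2) p) : extendVec y p = y :=
  FiberBundle.extend_apply_self _ y

end Chart

/-! ### Smooth orthonormal frames in a chart and the second fundamental form. -/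

section Frame

variable {M : Type*} [TopologicalSpace M] [ChartedSpace (EuclideanSpace ℝ (Fin 2)) M]
  [IsManifold (𝓡 2) ∞ M] {Φ : M → Mink} {p₀ q : M}

theorem differentiableAt_chartRep {F : Type*} [NormedAddCommGroup F] [NormedSpace ℝ F]
    (hq : q ∈ (extChartAt (𝓡 2) p₀).source) {V : M → F} (hV : ContMDiffAt (𝓡 2) 𝓘(ℝ, F) ∞ V q) :
    DifferentiableAt ℝ (chartRep p₀ V) (extChartAt (𝓡 2) p₀ q) :=
  (contDiffAt_chartRep hq hV).differentiableAt (by simp)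

/-- The Leibniz rule for the Lorentzian product of two fields, when that product is constant. -/
theorem lor_flatDeriv_of_const {V W : M → Mink} {c : ℝ} (hV : ContMDiffAt (𝓡 2) 𝓘(ℝ, Mink) ∞ V q)
    (hW : ContMDiffAt (𝓡 2) 𝓘(ℝ, Mink) ∞ W q) (h : ∀ r, lor (V r) (W r) = c)
    (x : TangentSpace (𝓡 2) q) :
    lor (flatDeriv V q x) (W q) = -lor (V q) (flatDeriv W q x) := by
  have hq := mem_extChartAt_source (I := 𝓡 2) q
  have h1 := fderiv_lor (differentiableAt_chartRep hq hV) (differentiableAt_chartRep hq hW)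
    (chartDiff q q x)
  have h2 : (fun z => lor (chartRep q V z) (chartRep q W z)) = fun _ => c :=
    funext fun z => h _
  rw [h2, chartRep_extChartAt hq, chartRep_extChartAt hq,
    ← flatDeriv_eq_fderiv_chartRep hq (hV.mdifferentiableAt (by simp)),
    ← flatDeriv_eq_fderiv_chartRep hq (hW.mdifferentiableAt (by simp))] at h1
  simp only [fderiv_fun_const, Pi.zero_apply, zero_apply] at h1
  linarith

/-- `Φ` is a smooth immersion of a surface into `ℍ⁴`. -/
structure IsHypImmersion (Φ : M → Mink) : Prop where
  smooth : ContMDiff (𝓡 2) 𝓘(ℝ, Mink) ∞ Φ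
  hyp : ∀ p, lor (Φ p) (Φ p) = -1
  immersion : ∀ p, Function.Injective (flatDeriv Φ p)

theorem IsPNMCBiconservative.isHypImmersion (hΦ : IsPNMCBiconservative Φ) : IsHypImmersion Φ :=
  ⟨hΦ.smooth, fun p => (hΦ.mem_hyperboloid p).1, hΦ.immersion⟩

namespace IsHypImmersion

theorem tangent (hΦ : IsHypImmersion Φ) (x : TangentSpace (𝓡 2) q) :
    lor (flatDeriv Φ q x) (Φ q) = 0 := by
  have := lor_flatDeriv_of_const (hΦ.smooth q) (hΦ.smooth q) hΦ.hyp x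
  rw [lor_comm (Φ q)] at this
  linarith

theorem flatDeriv_eq (hΦ : IsHypImmersion Φ) (hq : q ∈ (extChartAt (𝓡 2) p₀).source)
    (x : TangentSpace (𝓡 2) q) :
    flatDeriv Φ q x = fderiv ℝ (chartRep p₀ Φ) (extChartAt (𝓡 2) p₀ q) (chartDiff p₀ q x) :=
  flatDeriv_eq_fderiv_chartRep hq ((hΦ.smooth q).mdifferentiableAt (by simp)) x

theorem indMetric_pos (hΦ : IsHypImmersion Φ) {x : TangentSpace (𝓡 2) q} (hx : x ≠ 0) :
    0 < indMetric Φ q x x :=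
  lor_self_pos (hΦ.hyp q) (hΦ.tangent x) fun h => hx (hΦ.immersion q (by rw [h, map_zero]))

theorem pair (hΦ : IsHypImmersion Φ) {u₁ u₂ : TangentSpace (𝓡 2) q} (h₁ : indMetric Φ q u₁ u₁ = 1)
    (h₂ : indMetric Φ q u₂ u₂ = 1) (h₃ : indMetric Φ q u₁ u₂ = 0) :
    IsOrthonormalPair Φ q u₁ u₂ :=
  ⟨hΦ.hyp q, hΦ.tangent, h₁, h₂, h₃⟩

end IsHypImmersion

theorem exists_chartDiff_eq (hq : q ∈ (extChartAt (𝓡 2) p₀).source)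
    (x : EuclideanSpace ℝ (Fin 2)) : ∃ u, chartDiff p₀ q u = x := by
  obtain ⟨e, he⟩ := chartDiff_isInvertible hq
  exact ⟨e.symm x, by rw [← he]; exact e.apply_symm_apply x⟩

theorem exists_not_mem_span_singleton (y : EuclideanSpace ℝ (Fin 2)) :
    ∃ u : EuclideanSpace ℝ (Fin 2), ∀ c : ℝ, u - c • y ≠ 0 := by
  by_contra! h
  have h1 : (Submodule.span ℝ {y} : Submodule ℝ (EuclideanSpace ℝ (Fin 2))) = ⊤ := by
    rw [eq_top_iff]
    intro u _
    obtain ⟨c, hc⟩ := h u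
    exact Submodule.mem_span_singleton.2 ⟨c, (sub_eq_zero.1 hc).symm⟩
  have h2 := finrank_span_le_card (R := ℝ) ({y} : Set (EuclideanSpace ℝ (Fin 2)))
  rw [h1, finrank_top] at h2
  simp at h2

/-- A unit vector field completes locally to a smooth orthonormal frame. -/
theorem IsHypImmersion.exists_frame (hΦ : IsHypImmersion Φ) {Y : (p : M) → TangentSpace (𝓡 2) p}
    (hY : ContMDiff (𝓡 2) (𝓡 2).tangent ∞ fun p => (⟨p, Y p⟩ : TangentBundle (𝓡 2) M))
    (hY1 : ∀ p, indMetric Φ p (Y p) (Y p) = 1) (p₀ : M) :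
    ∃ (Ω : Set (EuclideanSpace ℝ (Fin 2)))
      (x₁ : EuclideanSpace ℝ (Fin 2) → EuclideanSpace ℝ (Fin 2)),
      extChartAt (𝓡 2) p₀ p₀ ∈ Ω ∧ Ω ⊆ (extChartAt (𝓡 2) p₀).target ∧
        IsOrthonormalFrame Ω (chartRep p₀ Φ) x₁ (fieldRep p₀ Y) := by
  set T := (extChartAt (𝓡 2) p₀).target with hT
  set v := chartRep p₀ Φ with hv
  set x₂ := fieldRep p₀ Y with hx₂
  have oT : IsOpen T := isOpen_extChartAt_target (I := 𝓡 2) p₀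
  have src : ∀ {z}, z ∈ T → (extChartAt (𝓡 2) p₀).symm z ∈ (extChartAt (𝓡 2) p₀).source :=
    fun hz => (extChartAt (𝓡 2) p₀).map_target hz
  have rinv : ∀ {z}, z ∈ T → extChartAt (𝓡 2) p₀ ((extChartAt (𝓡 2) p₀).symm z) = z :=
    fun hz => (extChartAt (𝓡 2) p₀).right_inv hz
  have sv : ContDiffOn ℝ ∞ v T := fun z hz => by
    have := contDiffAt_chartRep (src hz) (hΦ.smooth _)
    rw [rinv hz] at this
    exact this.contDiffWithinAt
  have s₂ : ContDiffOn ℝ ∞ x₂ T := fun z hz => by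
    have := contDiffAt_fieldRep (src hz) (hY _)
    rw [rinv hz] at this
    exact this.contDiffWithinAt
  have hypv : ∀ z, lor (v z) (v z) = -1 := fun z => hΦ.hyp _
  have dv : ∀ {z}, z ∈ T → ∀ u : TangentSpace (𝓡 2) ((extChartAt (𝓡 2) p₀).symm z),
      flatDeriv Φ _ u = fderiv ℝ v z (chartDiff p₀ _ u) := fun hz u => by
    rw [hΦ.flatDeriv_eq (src hz), rinv hz]
  have pos : ∀ {z}, z ∈ T → ∀ {u : EuclideanSpace ℝ (Fin 2)}, u ≠ 0 →
      0 < lor (fderiv ℝ v z u) (fderiv ℝ v z u) := fun hz u hu => by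
    obtain ⟨t, rfl⟩ := exists_chartDiff_eq (src hz) u
    rw [← dv hz]
    exact hΦ.indMetric_pos fun h => hu (by rw [h, map_zero])
  have unit₂ : ∀ z ∈ T, lor (dirDeriv x₂ v z) (dirDeriv x₂ v z) = 1 := fun z hz => by
    have := hY1 ((extChartAt (𝓡 2) p₀).symm z)
    rw [indMetric, dv hz] at this
    exact this
  have se₂ : ContDiffOn ℝ ∞ (dirDeriv x₂ v) T := contDiffOn_dirDeriv oT s₂ sv
  -- Gram–Schmidt applied to a constant coordinate vector, on the open set where the result is
  -- nonzero. Using `grad f` instead would be circular: smoothness of `H`, hence of `f`, is deduced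
  -- from the frame.
  obtain ⟨u, hu⟩ := exists_not_mem_span_singleton (x₂ (extChartAt (𝓡 2) p₀ p₀))
  set y : EuclideanSpace ℝ (Fin 2) → EuclideanSpace ℝ (Fin 2) :=
    fun z => u - lor (dirDeriv (fun _ => u) v z) (dirDeriv x₂ v z) • x₂ z with hy
  have sy : ContDiffOn ℝ ∞ y T := contDiffOn_const.sub
    (((contDiffOn_dirDeriv oT contDiffOn_const sv).lor se₂).smul s₂)
  have sy' : ContDiffOn ℝ ∞ (dirDeriv y v) T := contDiffOn_dirDeriv oT sy sv
  set N : EuclideanSpace ℝ (Fin 2) → ℝ := fun z => lor (dirDeriv y v z) (dirDeriv y v z) with hN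
  have sN : ContDiffOn ℝ ∞ N T := sy'.lor sy'
  set Ω : Set (EuclideanSpace ℝ (Fin 2)) := T ∩ N ⁻¹' Set.Ioi 0 with hΩ
  have oΩ : IsOpen Ω := sN.continuousOn.isOpen_inter_preimage oT isOpen_Ioi
  have subΩ : Ω ⊆ T := Set.inter_subset_left
  have sqN : ∀ z ∈ Ω, √(N z) ≠ 0 := fun z hz => (Real.sqrt_pos.2 hz.2).ne'
  set x₁ : EuclideanSpace ℝ (Fin 2) → EuclideanSpace ℝ (Fin 2) := fun z => (√(N z))⁻¹ • y z with hx₁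
  have e₁ : ∀ z, dirDeriv x₁ v z = (√(N z))⁻¹ • dirDeriv y v z := fun z => by
    simp [dirDeriv, hx₁]
  have unit₁ : ∀ z ∈ Ω, lor (dirDeriv x₁ v z) (dirDeriv x₁ v z) = 1 := fun z hz => by
    rw [e₁, lor_smul_left, lor_smul_right]
    change _ * (_ * N z) = 1
    have h1 := sqN z hz
    have h2 : √(N z) * √(N z) = N z := Real.mul_self_sqrt (le_of_lt hz.2)
    nth_rw 3 [← h2]
    field_simp
  have orth : ∀ z ∈ Ω, lor (dirDeriv x₁ v z) (dirDeriv x₂ v z) = 0 := fun z hz => by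
    have h1 : dirDeriv y v z = dirDeriv (fun _ => u) v z
        - lor (dirDeriv (fun _ => u) v z) (dirDeriv x₂ v z) • dirDeriv x₂ v z := by
      simp only [dirDeriv, hy, map_sub, map_smul]
    rw [e₁, lor_smul_left, h1, lor_sub_left, lor_smul_left, unit₂ z (subΩ hz)]
    ring
  refine ⟨Ω, x₁, ⟨mem_extChartAt_target p₀, pos (mem_extChartAt_target p₀) (hu _)⟩, subΩ,
    ⟨oΩ, sv.mono subΩ, ?_, s₂.mono subΩ, fun z _ => hypv z, unit₁,
      fun z hz => unit₂ z (subΩ hz), orth, ?_⟩⟩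
  · exact (((sN.mono subΩ).sqrt fun z hz => (ne_of_gt hz.2)).inv sqN).smul (sy.mono subΩ)
  · intro z hz w
    obtain ⟨t₁, ht₁⟩ := exists_chartDiff_eq (src (subΩ hz)) (x₁ z)
    obtain ⟨t, rfl⟩ := exists_chartDiff_eq (src (subΩ hz)) w
    have ft₁ := dv (subΩ hz) t₁
    have ft₂ := dv (subΩ hz) (Y _)
    rw [ht₁] at ft₁
    have pr : IsOrthonormalPair Φ _ t₁ (Y ((extChartAt (𝓡 2) p₀).symm z)) :=
      hΦ.pair (by rw [indMetric, ft₁]; exact unit₁ z hz) (hY1 _)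
        (by rw [indMetric, ft₁, ft₂]; exact orth z hz)
    have h1 := pr.tangentPart_flatDeriv t
    rw [pr.tangentPart_eq, ft₁, ft₂, dv (subΩ hz)] at h1
    have h2 : ∀ a b : ℝ, a • t₁ + b • Y ((extChartAt (𝓡 2) p₀).symm z) = t →
        chartDiff p₀ ((extChartAt (𝓡 2) p₀).symm z) t = a • x₁ z + b • x₂ z := by
      intro a b hab
      rw [← hab, map_add, map_smul, map_smul, ht₁]
      rfl
    exact h2 _ _ h1

/-- An orthonormal frame of the surface in the chart at `p₀`. -/
structure IsChartFrame (Φ : M → Mink) (p₀ : M) (Ω : Set (EuclideanSpace ℝ (Fin 2)))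
    (x₁ x₂ : EuclideanSpace ℝ (Fin 2) → EuclideanSpace ℝ (Fin 2)) : Prop
    extends IsOrthonormalFrame Ω (chartRep p₀ Φ) x₁ x₂ where
  immersion : IsHypImmersion Φ
  subset : Ω ⊆ (extChartAt (𝓡 2) p₀).target

/-- The vectors `u₁, u₂` of `T_q M` correspond to the frame `x₁, x₂` of the chart at `p₀`. -/
structure IsFrameAt (Φ : M → Mink) (p₀ : M)
    (x₁ x₂ : EuclideanSpace ℝ (Fin 2) → EuclideanSpace ℝ (Fin 2)) (q : M)
    (u₁ u₂ : TangentSpace (𝓡 2) q) : Prop extends IsOrthonormalPair Φ q u₁ u₂ where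
  mem : q ∈ (extChartAt (𝓡 2) p₀).source
  eq₁ : chartDiff p₀ q u₁ = x₁ (extChartAt (𝓡 2) p₀ q)
  eq₂ : chartDiff p₀ q u₂ = x₂ (extChartAt (𝓡 2) p₀ q)
  e₁ : flatDeriv Φ q u₁ = dirDeriv x₁ (chartRep p₀ Φ) (extChartAt (𝓡 2) p₀ q)
  e₂ : flatDeriv Φ q u₂ = dirDeriv x₂ (chartRep p₀ Φ) (extChartAt (𝓡 2) p₀ q)

variable {Ω : Set (EuclideanSpace ℝ (Fin 2))}
  {x₁ x₂ : EuclideanSpace ℝ (Fin 2) → EuclideanSpace ℝ (Fin 2)} {u₁ u₂ : TangentSpace (𝓡 2) q}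

theorem IsChartFrame.isFrameAt (h : IsChartFrame Φ p₀ Ω x₁ x₂)
    (hq : q ∈ (extChartAt (𝓡 2) p₀).source) (hz : extChartAt (𝓡 2) p₀ q ∈ Ω)
    (h₁ : chartDiff p₀ q u₁ = x₁ (extChartAt (𝓡 2) p₀ q))
    (h₂ : chartDiff p₀ q u₂ = x₂ (extChartAt (𝓡 2) p₀ q)) :
    IsFrameAt Φ p₀ x₁ x₂ q u₁ u₂ := by
  have e₁ : flatDeriv Φ q u₁ = dirDeriv x₁ (chartRep p₀ Φ) (extChartAt (𝓡 2) p₀ q) := by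
    rw [h.immersion.flatDeriv_eq hq, h₁, dirDeriv]
  have e₂ : flatDeriv Φ q u₂ = dirDeriv x₂ (chartRep p₀ Φ) (extChartAt (𝓡 2) p₀ q) := by
    rw [h.immersion.flatDeriv_eq hq, h₂, dirDeriv]
  exact ⟨h.immersion.pair (by rw [indMetric, e₁]; exact h.unit₁ _ hz)
    (by rw [indMetric, e₂]; exact h.unit₂ _ hz)
    (by rw [indMetric, e₁, e₂]; exact h.orth _ hz), hq, h₁, h₂, e₁, e₂⟩

theorem IsChartFrame.exists_isFrameAt (h : IsChartFrame Φ p₀ Ω x₁ x₂)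
    (hq : q ∈ (extChartAt (𝓡 2) p₀).source) (hz : extChartAt (𝓡 2) p₀ q ∈ Ω) :
    ∃ u₁ u₂, IsFrameAt Φ p₀ x₁ x₂ q u₁ u₂ := by
  obtain ⟨u₁, h₁⟩ := exists_chartDiff_eq hq (x₁ (extChartAt (𝓡 2) p₀ q))
  obtain ⟨u₂, h₂⟩ := exists_chartDiff_eq hq (x₂ (extChartAt (𝓡 2) p₀ q))
  exact ⟨u₁, u₂, h.isFrameAt hq hz h₁ h₂⟩

theorem IsFrameAt.range_fderiv (h : IsFrameAt Φ p₀ x₁ x₂ q u₁ u₂) (hΦ : IsHypImmersion Φ)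
    (c : EuclideanSpace ℝ (Fin 2)) :
    ∃ t, chartDiff p₀ q t = c ∧
      flatDeriv Φ q t = fderiv ℝ (chartRep p₀ Φ) (extChartAt (𝓡 2) p₀ q) c := by
  obtain ⟨t, rfl⟩ := exists_chartDiff_eq h.mem c
  exact ⟨t, rfl, hΦ.flatDeriv_eq h.mem t⟩

/-- The chosen extension of `y` enters only through its derivative, mapped by the differential of
`Φ` to a tangent vector. The normal part removes it, leaving a bilinear expression in `x` and `y`.
-/
theorem IsFrameAt.secondFF_eq (h : IsFrameAt Φ p₀ x₁ x₂ q u₁ u₂) (hΦ : IsHypImmersion Φ)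
    (x y : TangentSpace (𝓡 2) q) :
    secondFF Φ q x y = normalPart Φ q (fderiv ℝ (fderiv ℝ (chartRep p₀ Φ))
      (extChartAt (𝓡 2) p₀ q) (chartDiff p₀ q x) (chartDiff p₀ q y)) := by
  have h1 := flatDeriv_flatDeriv h.mem hΦ.smooth (contMDiffAt_extendVec y) x
  obtain ⟨t, -, ht⟩ := h.range_fderiv hΦ
    (fderiv ℝ (fieldRep p₀ (extendVec y)) (extChartAt (𝓡 2) p₀ q) (chartDiff p₀ q x))
  rw [extendVec_self, ← ht] at h1
  rw [secondFF, pullNabla, h.normalPart_hypProj]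
  change normalPart Φ q (flatDeriv (fun q => flatDeriv Φ q (extendVec y q)) q x) = _
  rw [h1, h.normalPart_add, h.normalPart_flatDeriv, add_zero]

theorem IsChartFrame.two_smul_meanCurv (h : IsChartFrame Φ p₀ Ω x₁ x₂)
    (hq : q ∈ (extChartAt (𝓡 2) p₀).source) (hz : extChartAt (𝓡 2) p₀ q ∈ Ω) :
    (2 : ℝ) • meanCurv Φ q = normalPart Φ q
      (dirDeriv x₁ (dirDeriv x₁ (chartRep p₀ Φ)) (extChartAt (𝓡 2) p₀ q)
        + dirDeriv x₂ (dirDeriv x₂ (chartRep p₀ Φ)) (extChartAt (𝓡 2) p₀ q)) := by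
  obtain ⟨u₁, u₂, hu⟩ := h.exists_isFrameAt hq hz
  have hΦ := h.immersion
  let b : TangentSpace (𝓡 2) q →ₗ[ℝ] TangentSpace (𝓡 2) q →ₗ[ℝ] Mink :=
    LinearMap.mk₂ ℝ (fun x y => normalPart Φ q (fderiv ℝ (fderiv ℝ (chartRep p₀ Φ))
      (extChartAt (𝓡 2) p₀ q) (chartDiff p₀ q x) (chartDiff p₀ q y)))
      (fun x x' y => by simp only [map_add, add_apply, hu.normalPart_add])
      (fun c x y => by simp only [map_smul, smul_apply, hu.normalPart_smul])
      (fun x y y' => by simp only [map_add, hu.normalPart_add])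
      (fun c x y => by simp only [map_smul, hu.normalPart_smul])
  have hb : secondFF Φ q = fun x y => b x y := by
    funext x y
    exact hu.secondFF_eq hΦ x y
  have hb' : ∀ x y, b x y = normalPart Φ q (fderiv ℝ (fderiv ℝ (chartRep p₀ Φ))
      (extChartAt (𝓡 2) p₀ q) (chartDiff p₀ q x) (chartDiff p₀ q y)) := fun _ _ => rfl
  rw [meanCurv, hb, hu.metricTrace_eq, hb', hb', hu.eq₁, hu.eq₂,
    fderiv_fderiv_eq h.isOpen h.smooth₁ h.smooth hz,
    fderiv_fderiv_eq h.isOpen h.smooth₂ h.smooth hz]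
  obtain ⟨t₁, -, ht₁⟩ := hu.range_fderiv hΦ (fderiv ℝ x₁ (extChartAt (𝓡 2) p₀ q)
    (x₁ (extChartAt (𝓡 2) p₀ q)))
  obtain ⟨t₂, -, ht₂⟩ := hu.range_fderiv hΦ (fderiv ℝ x₂ (extChartAt (𝓡 2) p₀ q)
    (x₂ (extChartAt (𝓡 2) p₀ q)))
  rw [← ht₁, ← ht₂, hu.normalPart_sub, hu.normalPart_sub, hu.normalPart_flatDeriv,
    hu.normalPart_flatDeriv, hu.normalPart_add]
  module

end Frame

/-! ### Smoothness of `H`, the gradient of `f`, and the rough Laplacian in a frame. -/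

section MeanCurvature

variable {M : Type*} [TopologicalSpace M] [ChartedSpace (EuclideanSpace ℝ (Fin 2)) M]
  [IsManifold (𝓡 2) ∞ M] {Φ : M → Mink} {p₀ q : M} {Ω : Set (EuclideanSpace ℝ (Fin 2))}
  {x₁ x₂ : EuclideanSpace ℝ (Fin 2) → EuclideanSpace ℝ (Fin 2)} {u₁ u₂ : TangentSpace (𝓡 2) q}
  {E₂ : (p : M) → TangentSpace (𝓡 2) p}

theorem IsFrameAt.normalPart_eq (h : IsFrameAt Φ p₀ x₁ x₂ q u₁ u₂) (w : Mink) :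
    normalPart Φ q w = frameNormal (chartRep p₀ Φ (extChartAt (𝓡 2) p₀ q))
      (dirDeriv x₁ (chartRep p₀ Φ) (extChartAt (𝓡 2) p₀ q))
      (dirDeriv x₂ (chartRep p₀ Φ) (extChartAt (𝓡 2) p₀ q)) w := by
  rw [h.toIsOrthonormalPair.normalPart_eq, h.e₁, h.e₂, chartRep_extChartAt h.mem]

/-- The point of `M` with coordinates `z`. -/
theorem IsChartFrame.exists_point (h : IsChartFrame Φ p₀ Ω x₁ x₂) {z : EuclideanSpace ℝ (Fin 2)}
    (hz : z ∈ Ω) : ∃ q u₁ u₂, IsFrameAt Φ p₀ x₁ x₂ q u₁ u₂ ∧ extChartAt (𝓡 2) p₀ q = z := by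
  have h1 := (extChartAt (𝓡 2) p₀).right_inv (h.subset hz)
  obtain ⟨u₁, u₂, hu⟩ := h.exists_isFrameAt ((extChartAt (𝓡 2) p₀).map_target (h.subset hz))
    (by rwa [h1])
  exact ⟨_, u₁, u₂, hu, h1⟩

theorem IsChartFrame.mean (h : IsChartFrame Φ p₀ Ω x₁ x₂) {z : EuclideanSpace ℝ (Fin 2)}
    (hz : z ∈ Ω) :
    frameNormal (chartRep p₀ Φ z) (dirDeriv x₁ (chartRep p₀ Φ) z) (dirDeriv x₂ (chartRep p₀ Φ) z)
      (dirDeriv x₁ (dirDeriv x₁ (chartRep p₀ Φ)) z + dirDeriv x₂ (dirDeriv x₂ (chartRep p₀ Φ)) z)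
      = (2 : ℝ) • chartRep p₀ (meanCurv Φ) z := by
  obtain ⟨q, u₁, u₂, hu, rfl⟩ := h.exists_point hz
  rw [chartRep_extChartAt hu.mem (meanCurv Φ), h.two_smul_meanCurv hu.mem hz, hu.normalPart_eq]

/-- The definition of `H` selects extensions point by point, so smoothness is read off from the
frame formula `mean` instead. -/
theorem IsChartFrame.contDiffOn_meanCurv (h : IsChartFrame Φ p₀ Ω x₁ x₂) :
    ContDiffOn ℝ ∞ (chartRep p₀ (meanCurv Φ)) Ω := by
  have c₁ := h.smooth_e₁
  have c₂ := h.smooth_e₂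
  have c := (contDiffOn_dirDeriv h.isOpen h.smooth₁ c₁).add
    (contDiffOn_dirDeriv h.isOpen h.smooth₂ c₂)
  have c' : ContDiffOn ℝ ∞ (fun z => frameNormal (chartRep p₀ Φ z)
      (dirDeriv x₁ (chartRep p₀ Φ) z) (dirDeriv x₂ (chartRep p₀ Φ) z)
      (dirDeriv x₁ (dirDeriv x₁ (chartRep p₀ Φ)) z
        + dirDeriv x₂ (dirDeriv x₂ (chartRep p₀ Φ)) z)) Ω :=
    (c.add ((c.lor h.smooth).smul h.smooth)).sub
      (((c.lor c₁).smul c₁).add ((c.lor c₂).smul c₂))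
  refine (c'.const_smul (1 / 2 : ℝ)).congr fun z hz => ?_
  rw [h.mean hz]
  module

theorem IsFieldE₂.exists_frame (hE : IsFieldE₂ Φ E₂) (hΦ : IsHypImmersion Φ) (p₀ : M) :
    ∃ Ω x₁, extChartAt (𝓡 2) p₀ p₀ ∈ Ω ∧ IsChartFrame Φ p₀ Ω x₁ (fieldRep p₀ E₂) := by
  obtain ⟨Ω, x₁, h1, h2, h3⟩ := hΦ.exists_frame hE.smooth hE.unit p₀
  exact ⟨Ω, x₁, h1, h3, hΦ, h2⟩

theorem IsFieldE₂.contMDiff_meanCurv (hE : IsFieldE₂ Φ E₂) (hΦ : IsHypImmersion Φ) :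
    ContMDiff (𝓡 2) 𝓘(ℝ, Mink) ∞ (meanCurv Φ) := by
  intro p₀
  obtain ⟨Ω, x₁, hz, h⟩ := hE.exists_frame hΦ p₀
  exact contMDiffAt_of_chartRep (mem_extChartAt_source p₀)
    (h.contDiffOn_meanCurv.contDiffAt (h.isOpen.mem_nhds hz))

theorem IsFieldE₂.lor_meanCurv_self (hE : IsFieldE₂ Φ E₂) (hΦ : IsHypImmersion Φ) (q : M) :
    lor (meanCurv Φ q) (Φ q) = 0 := by
  obtain ⟨Ω, x₁, hz, h⟩ := hE.exists_frame hΦ q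
  have hq := mem_extChartAt_source (I := 𝓡 2) q
  obtain ⟨u₁, u₂, hu⟩ := h.exists_isFrameAt hq hz
  have h1 := congrArg (fun w => lor w (Φ q)) (h.two_smul_meanCurv hq hz)
  simp only [lor_smul_left, hu.lor_normalPart_self] at h1
  linarith

theorem IsFieldE₂.lor_meanCurv_flatDeriv (hE : IsFieldE₂ Φ E₂) (hΦ : IsHypImmersion Φ) (q : M)
    (x : TangentSpace (𝓡 2) q) : lor (meanCurv Φ q) (flatDeriv Φ q x) = 0 := by
  obtain ⟨Ω, x₁, hz, h⟩ := hE.exists_frame hΦ q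
  have hq := mem_extChartAt_source (I := 𝓡 2) q
  obtain ⟨u₁, u₂, hu⟩ := h.exists_isFrameAt hq hz
  have h1 := congrArg (fun w => lor w (flatDeriv Φ q x)) (h.two_smul_meanCurv hq hz)
  simp only [lor_smul_left, hu.lor_normalPart_flatDeriv] at h1
  linarith

/-- The normalized mean curvature field `H / |H|`. -/
def unitMeanCurv (Φ : M → Mink) (q : M) : Mink := (1 / meanCurvFun Φ q) • meanCurv Φ q

theorem IsPNMCBiconservative.lor_meanCurv_pos (hΦ : IsPNMCBiconservative Φ) (q : M) :
    0 < lor (meanCurv Φ q) (meanCurv Φ q) :=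
  Real.sqrt_pos.1 (hΦ.meanCurvFun_pos q)

theorem IsPNMCBiconservative.smul_unitMeanCurv (hΦ : IsPNMCBiconservative Φ) (q : M) :
    meanCurvFun Φ q • unitMeanCurv Φ q = meanCurv Φ q := by
  rw [unitMeanCurv, smul_smul, mul_one_div_cancel (hΦ.meanCurvFun_pos q).ne', one_smul]

theorem IsPNMCBiconservative.lor_unitMeanCurv (hΦ : IsPNMCBiconservative Φ) (q : M) :
    lor (unitMeanCurv Φ q) (unitMeanCurv Φ q) = 1 := by
  have h1 := hΦ.meanCurvFun_pos q
  have h2 : meanCurvFun Φ q * meanCurvFun Φ q = lor (meanCurv Φ q) (meanCurv Φ q) :=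
    Real.mul_self_sqrt (hΦ.lor_meanCurv_pos q).le
  rw [unitMeanCurv, lor_smul_left, lor_smul_right, ← h2]
  field_simp

theorem _root_.ContDiffAt.lor {E : Type*} [NormedAddCommGroup E] [NormedSpace ℝ E]
    {n : WithTop ℕ∞} {V W : E → Mink} {z : E} (hV : ContDiffAt ℝ n V z)
    (hW : ContDiffAt ℝ n W z) : ContDiffAt ℝ n (fun z => lor (V z) (W z)) z :=
  (lorL.contDiff.contDiffAt.comp z hV).clm_apply hW

theorem IsPNMCBiconservative.contMDiff_meanCurvFun (hΦ : IsPNMCBiconservative Φ)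
    (hE : IsFieldE₂ Φ E₂) : ContMDiff (𝓡 2) 𝓘(ℝ, ℝ) ∞ (meanCurvFun Φ) := by
  intro p
  have hp := mem_extChartAt_source (I := 𝓡 2) p
  have h1 := contDiffAt_chartRep hp (hE.contMDiff_meanCurv hΦ.isHypImmersion p)
  exact contMDiffAt_of_chartRep hp ((h1.lor h1).sqrt (hΦ.lor_meanCurv_pos _).ne')

theorem IsPNMCBiconservative.contMDiff_unitMeanCurv (hΦ : IsPNMCBiconservative Φ)
    (hE : IsFieldE₂ Φ E₂) : ContMDiff (𝓡 2) 𝓘(ℝ, Mink) ∞ (unitMeanCurv Φ) := by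
  intro p
  have hp := mem_extChartAt_source (I := 𝓡 2) p
  have h1 := contDiffAt_chartRep hp (hE.contMDiff_meanCurv hΦ.isHypImmersion p)
  have h2 := contDiffAt_chartRep hp (hΦ.contMDiff_meanCurvFun hE p)
  exact contMDiffAt_of_chartRep hp
    ((contDiffAt_const.div h2 (hΦ.meanCurvFun_pos _).ne').smul h1)

/-! ### The gradient of the mean curvature function -/

/-- The differential of a function on the surface. -/
def fnDiff (u : M → ℝ) (p : M) : TangentSpace (𝓡 2) p →L[ℝ] ℝ := mfderiv (𝓡 2) 𝓘(ℝ, ℝ) u p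

theorem IsOrthonormalPair.gradient_eq (h : IsOrthonormalPair Φ q u₁ u₂) (f : M → ℝ) :
    gradient Φ f q = fnDiff f q u₁ • u₁ + fnDiff f q u₂ • u₂ :=
  h.sharp_eq (fnDiff f q).toLinearMap

/-- `E₁` is a nonzero multiple of `grad f`, so `E₂ ⟂ E₁` means that `f` is stationary along `E₂`. -/
theorem IsPNMCBiconservative.fnDiff_E₂ (hΦ : IsPNMCBiconservative Φ) (hE : IsFieldE₂ Φ E₂)
    {u : TangentSpace (𝓡 2) q} (h : IsOrthonormalPair Φ q u (E₂ q)) :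
    fnDiff (meanCurvFun Φ) q (E₂ q) = 0 := by
  have h1 := hE.orthogonal q
  have h2 := hΦ.isHypImmersion.indMetric_pos (hΦ.gradient_ne_zero q)
  have h3 := h.orth
  have h4 := h.unit₂
  rw [fieldE₁, indMetric, map_smul, lor_smul_left] at h1
  have h5 := (mul_eq_zero.1 h1).resolve_left (one_div_ne_zero (Real.sqrt_pos.2 h2).ne')
  simp only [indMetric] at h3 h4
  rw [h.gradient_eq, map_add, map_smul, map_smul, lor_add_left, lor_smul_left, lor_smul_left, h3,
    h4] at h5
  linarith

theorem IsPNMCBiconservative.fnDiff_ne_zero (hΦ : IsPNMCBiconservative Φ) (hE : IsFieldE₂ Φ E₂)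
    {u : TangentSpace (𝓡 2) q} (h : IsOrthonormalPair Φ q u (E₂ q)) :
    fnDiff (meanCurvFun Φ) q u ≠ 0 := by
  intro h0
  have h1 := hΦ.gradient_ne_zero q
  rw [h.gradient_eq, h0, hΦ.fnDiff_E₂ hE h] at h1
  simp at h1

/-! ### The tangential part of the bitension field -/

theorem pullNabla_of_normal {V : M → Mink} (hΦ : IsHypImmersion Φ)
    (hV : ContMDiff (𝓡 2) 𝓘(ℝ, Mink) ∞ V) (h₀ : ∀ r, lor (V r) (Φ r) = 0)
    (h₁ : ∀ r x, lor (V r) (flatDeriv Φ r x) = 0) (x : TangentSpace (𝓡 2) q) :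
    pullNabla Φ V q x = flatDeriv V q x := by
  rw [pullNabla, hypProj_of_orthogonal]
  rw [lor_flatDeriv_of_const (hV q) (hΦ.smooth q) h₀, h₁, neg_zero]

/-- The integrand of the rough Laplacian of a normal field, in the chart at `p₀`. -/
theorem IsFrameAt.roughLaplacian_integrand (h : IsFrameAt Φ p₀ x₁ x₂ q u₁ u₂)
    (hΦ : IsHypImmersion Φ) {V : M → Mink} (hV : ContMDiff (𝓡 2) 𝓘(ℝ, Mink) ∞ V)
    (h₀ : ∀ r, lor (V r) (Φ r) = 0) (h₁ : ∀ r x, lor (V r) (flatDeriv Φ r x) = 0)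
    (x y : TangentSpace (𝓡 2) q) :
    pullNabla Φ (fun q => pullNabla Φ V q (extendVec y q)) q x
        - pullNabla Φ V q (surfNabla Φ (extendVec y) q x)
      = hypProj (Φ q) (fderiv ℝ (fderiv ℝ (chartRep p₀ V)) (extChartAt (𝓡 2) p₀ q)
          (chartDiff p₀ q x) (chartDiff p₀ q y))
        - flatDeriv V q (tangentPart Φ q (fderiv ℝ (fderiv ℝ (chartRep p₀ Φ))
          (extChartAt (𝓡 2) p₀ q) (chartDiff p₀ q x) (chartDiff p₀ q y))) := by
  have hn : ∀ {r} (x : TangentSpace (𝓡 2) r), pullNabla Φ V r x = flatDeriv V r x :=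
    fun x => pullNabla_of_normal hΦ hV h₀ h₁ x
  have hp : ∀ {r} (x : TangentSpace (𝓡 2) r), hypProj (Φ r) (flatDeriv V r x) = flatDeriv V r x :=
    fun x => hn x
  simp only [hn]
  -- `t` is the derivative of the extension of `y` along `x`. It occurs in the iterated derivative
  -- of `V` and in the Levi-Civita correction, and the two contributions cancel.
  obtain ⟨t, ht, ht'⟩ := h.range_fderiv hΦ
    (fderiv ℝ (fieldRep p₀ (extendVec y)) (extChartAt (𝓡 2) p₀ q) (chartDiff p₀ q x))
  have h2 := flatDeriv_flatDeriv h.mem hΦ.smooth (contMDiffAt_extendVec y) x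
  have h3 := flatDeriv_flatDeriv h.mem hV (contMDiffAt_extendVec y) x
  rw [extendVec_self, ← ht'] at h2
  rw [extendVec_self, ← ht,
    ← flatDeriv_eq_fderiv_chartRep h.mem ((hV q).mdifferentiableAt (by simp))] at h3
  have h4 : surfNabla Φ (extendVec y) q x
      = tangentPart Φ q (fderiv ℝ (fderiv ℝ (chartRep p₀ Φ))
          (extChartAt (𝓡 2) p₀ q) (chartDiff p₀ q x) (chartDiff p₀ q y)) + t := by
    rw [surfNabla, pullNabla, h.tangentPart_hypProj]
    change tangentPart Φ q (flatDeriv (fun q => flatDeriv Φ q (extendVec y q)) q x) = _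
    rw [h2, h.tangentPart_add, h.tangentPart_flatDeriv]
  rw [pullNabla, h3, h4, hypProj_add, hp, map_add]
  abel

theorem IsFrameAt.metricTrace_roughLaplacian (h : IsFrameAt Φ p₀ x₁ x₂ q u₁ u₂)
    (hΦ : IsHypImmersion Φ) {V : M → Mink} (hV : ContMDiff (𝓡 2) 𝓘(ℝ, Mink) ∞ V)
    (h₀ : ∀ r, lor (V r) (Φ r) = 0) (h₁ : ∀ r x, lor (V r) (flatDeriv Φ r x) = 0) :
    -roughLaplacian Φ V q =
      (hypProj (Φ q) (fderiv ℝ (fderiv ℝ (chartRep p₀ V)) (extChartAt (𝓡 2) p₀ q)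
          (chartDiff p₀ q u₁) (chartDiff p₀ q u₁))
        - flatDeriv V q (tangentPart Φ q (fderiv ℝ (fderiv ℝ (chartRep p₀ Φ))
          (extChartAt (𝓡 2) p₀ q) (chartDiff p₀ q u₁) (chartDiff p₀ q u₁)))) +
      (hypProj (Φ q) (fderiv ℝ (fderiv ℝ (chartRep p₀ V)) (extChartAt (𝓡 2) p₀ q)
          (chartDiff p₀ q u₂) (chartDiff p₀ q u₂))
        - flatDeriv V q (tangentPart Φ q (fderiv ℝ (fderiv ℝ (chartRep p₀ Φ))
          (extChartAt (𝓡 2) p₀ q) (chartDiff p₀ q u₂) (chartDiff p₀ q u₂)))) := by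
  let b : TangentSpace (𝓡 2) q →ₗ[ℝ] TangentSpace (𝓡 2) q →ₗ[ℝ] Mink :=
    LinearMap.mk₂ ℝ (fun x y => hypProj (Φ q) (fderiv ℝ (fderiv ℝ (chartRep p₀ V))
        (extChartAt (𝓡 2) p₀ q) (chartDiff p₀ q x) (chartDiff p₀ q y))
        - flatDeriv V q (tangentPart Φ q (fderiv ℝ (fderiv ℝ (chartRep p₀ Φ))
          (extChartAt (𝓡 2) p₀ q) (chartDiff p₀ q x) (chartDiff p₀ q y))))
      (fun x x' y => by
        simp only [map_add, add_apply, h.tangentPart_add, hypProj_add]; abel)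
      (fun c x y => by
        simp only [map_smul, smul_apply, h.tangentPart_smul, hypProj_smul, smul_sub])
      (fun x y y' => by simp only [map_add, h.tangentPart_add, hypProj_add]; abel)
      (fun c x y => by simp only [map_smul, h.tangentPart_smul, hypProj_smul, smul_sub])
  rw [roughLaplacian, neg_neg]
  simp only [h.roughLaplacian_integrand hΦ hV h₀ h₁]
  exact h.metricTrace_eq b

/-- In constant curvature `R(x, t)y = ⟨x, y⟩ t - ⟨t, y⟩ x`, which for normal `t` is a multiple of
`t`. Thus the curvature term of the bitension field is normal. -/
theorem IsHypImmersion.lor_metricTrace_hypCurvature (hΦ : IsHypImmersion Φ) {t : Mink}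
    (h₀ : lor t (Φ q) = 0) (h₁ : ∀ x, lor t (flatDeriv Φ q x) = 0) (u : TangentSpace (𝓡 2) q) :
    lor (metricTrace Φ q fun x y => hypCurvature (Φ q) (flatDeriv Φ q x) t (flatDeriv Φ q y))
      (flatDeriv Φ q u) = 0 := by
  simp only [metricTrace, hypCurvature_eq (hΦ.hyp q) (hΦ.tangent _) h₀ (hΦ.tangent _), h₁,
    Fin.sum_univ_two, lor_add_left, lor_smul_left, lor_sub_left]
  ring

theorem IsChartFrame.lor_roughLaplacian (h : IsChartFrame Φ p₀ Ω x₁ x₂)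
    (hu : IsFrameAt Φ p₀ x₁ x₂ q u₁ u₂) (hz : extChartAt (𝓡 2) p₀ q ∈ Ω) {V : M → Mink}
    (hV : ContMDiff (𝓡 2) 𝓘(ℝ, Mink) ∞ V) (hVΩ : ContDiffOn ℝ ∞ (chartRep p₀ V) Ω)
    (h₀ : ∀ r, lor (V r) (Φ r) = 0) (h₁ : ∀ r x, lor (V r) (flatDeriv Φ r x) = 0)
    {z : EuclideanSpace ℝ (Fin 2)} (hqz : extChartAt (𝓡 2) p₀ q = z) (u : TangentSpace (𝓡 2) q) :
    lor (-roughLaplacian Φ V q) (flatDeriv Φ q u)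
      = lor (dirDeriv x₁ (dirDeriv x₁ (chartRep p₀ V)) z
        + dirDeriv x₂ (dirDeriv x₂ (chartRep p₀ V)) z
        - (lor (dirDeriv x₁ (dirDeriv x₁ (chartRep p₀ Φ)) z) (dirDeriv x₂ (chartRep p₀ Φ) z) •
            dirDeriv x₂ (chartRep p₀ V) z
          + lor (dirDeriv x₂ (dirDeriv x₂ (chartRep p₀ Φ)) z) (dirDeriv x₁ (chartRep p₀ Φ) z) •
            dirDeriv x₁ (chartRep p₀ V) z)) (flatDeriv Φ q u) := by
  subst hqz
  have hΦ := h.immersion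
  have fV : ∀ x : TangentSpace (𝓡 2) q, flatDeriv V q x = _ := fun x =>
    flatDeriv_eq_fderiv_chartRep hu.mem ((hV q).mdifferentiableAt (by simp)) x
  have hl : ∀ w, lor (hypProj (Φ q) w) (flatDeriv Φ q u) = lor w (flatDeriv Φ q u) := fun w => by
    rw [hypProj, lor_add_left, lor_smul_left, lor_comm (Φ q), hΦ.tangent, mul_zero, add_zero]
  obtain ⟨t₁, ht₁, ht₁'⟩ := hu.range_fderiv hΦ (fderiv ℝ x₁ (extChartAt (𝓡 2) p₀ q)
    (x₁ (extChartAt (𝓡 2) p₀ q)))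
  obtain ⟨t₂, ht₂, ht₂'⟩ := hu.range_fderiv hΦ (fderiv ℝ x₂ (extChartAt (𝓡 2) p₀ q)
    (x₂ (extChartAt (𝓡 2) p₀ q)))
  -- The tangential Hessian plays the role of Christoffel symbols; adding the derivative of `x₁`
  -- gives `∇_{u₁}u₁ = a u₂`. Likewise `T₂` is `∇_{u₂}u₂ = w u₁`.
  have T₁ : tangentPart Φ q (fderiv ℝ (fderiv ℝ (chartRep p₀ Φ)) (extChartAt (𝓡 2) p₀ q)
      (chartDiff p₀ q u₁) (chartDiff p₀ q u₁)) + t₁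
      = lor (dirDeriv x₁ (dirDeriv x₁ (chartRep p₀ Φ)) (extChartAt (𝓡 2) p₀ q))
        (dirDeriv x₂ (chartRep p₀ Φ) (extChartAt (𝓡 2) p₀ q)) • u₂ := by
    rw [← hu.tangentPart_flatDeriv t₁, ← hu.tangentPart_add, hu.eq₁,
      fderiv_fderiv_eq h.isOpen h.smooth₁ h.smooth hz, ← ht₁', sub_add_cancel,
      hu.tangentPart_eq, hu.e₁, hu.e₂, h.lor_De₁_e₁ hz, zero_smul, zero_add]
  have T₂ : tangentPart Φ q (fderiv ℝ (fderiv ℝ (chartRep p₀ Φ)) (extChartAt (𝓡 2) p₀ q)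
      (chartDiff p₀ q u₂) (chartDiff p₀ q u₂)) + t₂
      = lor (dirDeriv x₂ (dirDeriv x₂ (chartRep p₀ Φ)) (extChartAt (𝓡 2) p₀ q))
        (dirDeriv x₁ (chartRep p₀ Φ) (extChartAt (𝓡 2) p₀ q)) • u₁ := by
    rw [← hu.tangentPart_flatDeriv t₂, ← hu.tangentPart_add, hu.eq₂,
      fderiv_fderiv_eq h.isOpen h.smooth₂ h.smooth hz, ← ht₂', sub_add_cancel,
      hu.tangentPart_eq, hu.e₁, hu.e₂, h.lor_De₂_e₂ hz, zero_smul, add_zero]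
  have F₁ := congrArg (flatDeriv V q) T₁
  have F₂ := congrArg (flatDeriv V q) T₂
  have W₁ : flatDeriv V q u₁ = dirDeriv x₁ (chartRep p₀ V) (extChartAt (𝓡 2) p₀ q) := by
    rw [fV, hu.eq₁, dirDeriv]
  have W₂ : flatDeriv V q u₂ = dirDeriv x₂ (chartRep p₀ V) (extChartAt (𝓡 2) p₀ q) := by
    rw [fV, hu.eq₂, dirDeriv]
  have S₁ := fV t₁
  have S₂ := fV t₂
  rw [ht₁] at S₁
  rw [ht₂] at S₂
  rw [map_add, map_smul, W₂] at F₁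
  rw [map_add, map_smul, W₁] at F₂
  rw [hu.metricTrace_roughLaplacian hΦ hV h₀ h₁, eq_sub_of_add_eq F₁, eq_sub_of_add_eq F₂, hu.eq₁,
    hu.eq₂, fderiv_fderiv_eq h.isOpen h.smooth₁ hVΩ hz, fderiv_fderiv_eq h.isOpen h.smooth₂ hVΩ hz,
    ← S₁, ← S₂]
  simp only [lor_add_left, lor_sub_left, hl]
  ring

end MeanCurvature

/-! ### From the geometric hypotheses to the frame equations. -/

section BiconservativeSurface

variable {M : Type*} [TopologicalSpace M] [ChartedSpace (EuclideanSpace ℝ (Fin 2)) M]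
  [IsManifold (𝓡 2) ∞ M] {Φ : M → Mink} {p₀ : M} {Ω : Set (EuclideanSpace ℝ (Fin 2))}
  {x₁ : EuclideanSpace ℝ (Fin 2) → EuclideanSpace ℝ (Fin 2)}
  {E₂ : (p : M) → TangentSpace (𝓡 2) p}

theorem IsPNMCBiconservative.lor_roughLaplacian (hΦ : IsPNMCBiconservative Φ)
    (hE : IsFieldE₂ Φ E₂) {q : M} {u₁ u₂ : TangentSpace (𝓡 2) q}
    (h : IsOrthonormalPair Φ q u₁ u₂) (u : TangentSpace (𝓡 2) q) :
    lor (-roughLaplacian Φ (tension Φ) q) (flatDeriv Φ q u) = 0 := by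
  have h1 := h.lor_eq_zero_of_tangentPart (hΦ.biconservative q) u
  have h0 : lor (tension Φ q) (Φ q) = 0 := by
    rw [tension, lor_smul_left, hE.lor_meanCurv_self hΦ.isHypImmersion, mul_zero]
  have h2 : ∀ x, lor (tension Φ q) (flatDeriv Φ q x) = 0 := fun x => by
    rw [tension, lor_smul_left, hE.lor_meanCurv_flatDeriv hΦ.isHypImmersion, mul_zero]
  rw [bitension, lor_sub_left, hΦ.isHypImmersion.lor_metricTrace_hypCurvature h0 h2,
    sub_zero] at h1
  exact h1

theorem dirDeriv_two_smul {E : Type*} [NormedAddCommGroup E] [NormedSpace ℝ E] (x : E → E)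
    (W : E → Mink) : dirDeriv x (fun z => (2 : ℝ) • W z) = fun z => (2 : ℝ) • dirDeriv x W z := by
  funext z
  have : (fun z => (2 : ℝ) • W z) = (2 : ℝ) • W := rfl
  rw [dirDeriv, this, fderiv_const_smul_field]
  rfl

/-- The frame equations of a PNMC biconservative surface. -/
theorem IsPNMCBiconservative.isBiconservativeFrame (hΦ : IsPNMCBiconservative Φ)
    (hE : IsFieldE₂ Φ E₂) (h : IsChartFrame Φ p₀ Ω x₁ (fieldRep p₀ E₂)) :
    IsBiconservativeFrame Ω (chartRep p₀ Φ) x₁ (fieldRep p₀ E₂) (chartRep p₀ (meanCurvFun Φ))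
      (chartRep p₀ (unitMeanCurv Φ)) := by
  have hI := hΦ.isHypImmersion
  have sf := hΦ.contMDiff_meanCurvFun hE
  have sn := hΦ.contMDiff_unitMeanCurv hE
  have sH := hE.contMDiff_meanCurv hI
  have cd : ∀ {F : Type} [NormedAddCommGroup F] [NormedSpace ℝ F] {V : M → F},
      ContMDiff (𝓡 2) 𝓘(ℝ, F) ∞ V → ContDiffOn ℝ ∞ (chartRep p₀ V) Ω := by
    intro F _ _ V hV z hz
    have h1 := contDiffAt_chartRep ((extChartAt (𝓡 2) p₀).map_target (h.subset hz)) (hV _)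
    rw [(extChartAt (𝓡 2) p₀).right_inv (h.subset hz)] at h1
    exact h1.contDiffWithinAt
  -- The second vector is exactly `E₂ q`; the first is `±E₁`, and the sign is immaterial because
  -- only `D₁f ≠ 0` is required.
  have frame : ∀ {z}, z ∈ Ω → ∃ (q : M) (u : TangentSpace (𝓡 2) q),
      IsFrameAt Φ p₀ x₁ (fieldRep p₀ E₂) q u (E₂ q) ∧ extChartAt (𝓡 2) p₀ q = z := by
    intro z hz
    obtain ⟨q, u₁, u₂, hu, rfl⟩ := h.exists_point hz
    exact ⟨q, u₁, h.isFrameAt hu.mem hz hu.eq₁ (fieldRep_extChartAt hu.mem E₂).symm, rfl⟩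
  have n_e : ∀ q (x : TangentSpace (𝓡 2) q), lor (unitMeanCurv Φ q) (flatDeriv Φ q x) = 0 :=
    fun q x => by rw [unitMeanCurv, lor_smul_left, hE.lor_meanCurv_flatDeriv hI, mul_zero]
  have par : ∀ {q : M} {u₁ u₂ : TangentSpace (𝓡 2) q}
      (_ : IsFrameAt Φ p₀ x₁ (fieldRep p₀ E₂) q u₁ u₂) (u : TangentSpace (𝓡 2) q),
      normalPart Φ q (flatDeriv (unitMeanCurv Φ) q u) = 0 := fun {q} _ _ hu u => by
    have h1 := hΦ.parallel q u
    rw [normalNabla, pullNabla, hu.normalPart_hypProj] at h1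
    exact h1
  have dn : ∀ {q : M}, q ∈ (extChartAt (𝓡 2) p₀).source → ∀ x : TangentSpace (𝓡 2) q,
      flatDeriv (unitMeanCurv Φ) q x = _ := fun hq x =>
    flatDeriv_eq_fderiv_chartRep hq ((sn _).mdifferentiableAt (by simp)) x
  have df : ∀ {q : M}, q ∈ (extChartAt (𝓡 2) p₀).source → ∀ x : TangentSpace (𝓡 2) q,
      fnDiff (meanCurvFun Φ) q x = _ := fun hq x =>
    mfderiv_eq_fderiv_chartRep hq ((sf _).mdifferentiableAt (by simp)) x
  have hfn : (fun z => chartRep p₀ (meanCurvFun Φ) z • chartRep p₀ (unitMeanCurv Φ) z)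
      = chartRep p₀ (meanCurv Φ) := funext fun z => hΦ.smul_unitMeanCurv _
  refine { h.toIsOrthonormalFrame with
    smooth_f := cd sf
    smooth_n := cd sn
    f_pos := fun z _ => hΦ.meanCurvFun_pos _
    n_unit := fun z _ => hΦ.lor_unitMeanCurv _
    n_v := fun z _ => ?_
    n_e₁ := fun z hz => ?_
    n_e₂ := fun z hz => ?_
    mean := fun z hz => ?_
    parallel₁ := fun z hz => ?_
    parallel₂ := fun z hz => ?_
    bicons := fun z hz e he => ?_
    df₁ := fun z hz => ?_
    df₂ := fun z hz => ?_ }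
  · rw [chartRep, chartRep, unitMeanCurv, lor_smul_left, hE.lor_meanCurv_self hI, mul_zero]
  · obtain ⟨q, u, hu, rfl⟩ := frame hz
    rw [← hu.e₁, chartRep_extChartAt hu.mem, n_e]
  · obtain ⟨q, u, hu, rfl⟩ := frame hz
    rw [← hu.e₂, chartRep_extChartAt hu.mem, n_e]
  · rw [h.mean hz, ← hfn, smul_smul]
  · obtain ⟨q, u, hu, rfl⟩ := frame hz
    rw [← hu.normalPart_eq, ← par hu u, dn hu.mem, hu.eq₁, dirDeriv]
  · obtain ⟨q, u, hu, rfl⟩ := frame hz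
    rw [← hu.normalPart_eq, ← par hu (E₂ q), dn hu.mem, hu.eq₂, dirDeriv]
  · obtain ⟨q, u, hu, rfl⟩ := frame hz
    obtain ⟨t, rfl⟩ : ∃ t, flatDeriv Φ q t = e := by
      rcases he with rfl | rfl
      · exact ⟨u, hu.e₁⟩
      · exact ⟨E₂ q, hu.e₂⟩
    have hT : chartRep p₀ (tension Φ) = fun z => (2 : ℝ) • chartRep p₀ (meanCurv Φ) z := rfl
    have sT : ContMDiff (𝓡 2) 𝓘(ℝ, Mink) ∞ (tension Φ) := fun p =>
      contMDiffAt_of_chartRep (mem_extChartAt_source p)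
        ((contDiffAt_chartRep (mem_extChartAt_source p) (sH p)).const_smul (2 : ℝ))
    have h1 := hΦ.lor_roughLaplacian hE hu.toIsOrthonormalPair t
    rw [h.lor_roughLaplacian hu hz sT (cd sT)
      (fun r => by rw [tension, lor_smul_left, hE.lor_meanCurv_self hI, mul_zero])
      (fun r x => by rw [tension, lor_smul_left, hE.lor_meanCurv_flatDeriv hI, mul_zero]) rfl t,
      hT] at h1
    simp only [dirDeriv_two_smul, lor_add_left, lor_sub_left, lor_smul_left] at h1
    rw [hfn]
    simp only [lor_add_left, lor_sub_left, lor_smul_left]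
    linarith
  · obtain ⟨q, u, hu, rfl⟩ := frame hz
    have h1 := hΦ.fnDiff_ne_zero hE hu.toIsOrthonormalPair
    rwa [df hu.mem, hu.eq₁] at h1
  · obtain ⟨q, u, hu, rfl⟩ := frame hz
    have h1 := hΦ.fnDiff_E₂ hE hu.toIsOrthonormalPair
    rwa [df hu.mem, hu.eq₂] at h1

theorem IsFieldE₂.contMDiff_push (hE : IsFieldE₂ Φ E₂) (hΦ : IsHypImmersion Φ) :
    ContMDiff (𝓡 2) 𝓘(ℝ, Mink) ∞ (push Φ E₂) := fun p =>
  contMDiffAt_flatDeriv_apply hΦ.smooth (hE.smooth p)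

theorem IsFieldE₂.contMDiff_flatAccel (hE : IsFieldE₂ Φ E₂) (hΦ : IsHypImmersion Φ) :
    ContMDiff (𝓡 2) 𝓘(ℝ, Mink) ∞ (flatAccel Φ E₂) := fun p =>
  contMDiffAt_flatDeriv_apply (hE.contMDiff_push hΦ) (hE.smooth p)

/-- `∇̂_{E₂} ∇̂_{E₂} E₂ = -⟨∇̂_{E₂} E₂, ∇̂_{E₂} E₂⟩ E₂`. -/
theorem IsPNMCBiconservative.flatDeriv_flatAccel (hΦ : IsPNMCBiconservative Φ)
    (hE : IsFieldE₂ Φ E₂) (p : M) :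
    flatDeriv (flatAccel Φ E₂) p (E₂ p)
      = (-lor (flatAccel Φ E₂ p) (flatAccel Φ E₂ p)) • push Φ E₂ p := by
  have hI := hΦ.isHypImmersion
  obtain ⟨Ω, x₁, hz, h⟩ := hE.exists_frame hI p
  have key := (hΦ.isBiconservativeFrame hE h).deriv_accel hz
  have hp := mem_extChartAt_source (I := 𝓡 2) p
  have oT := isOpen_extChartAt_target (I := 𝓡 2) p
  have r₁ : ∀ z ∈ (extChartAt (𝓡 2) p).target, chartRep p (push Φ E₂) z
      = dirDeriv (fieldRep p E₂) (chartRep p Φ) z := fun z hz =>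
    chartRep_flatDeriv hI.smooth E₂ hz
  have r₂ : ∀ z ∈ (extChartAt (𝓡 2) p).target, chartRep p (flatAccel Φ E₂) z
      = dirDeriv (fieldRep p E₂) (dirDeriv (fieldRep p E₂) (chartRep p Φ)) z := fun z hz =>
    (chartRep_flatDeriv (hE.contMDiff_push hI) E₂ hz).trans (dirDeriv_congr oT r₁ hz)
  have r₃ : ∀ z ∈ (extChartAt (𝓡 2) p).target,
      chartRep p (fun q => flatDeriv (flatAccel Φ E₂) q (E₂ q)) z
      = dirDeriv (fieldRep p E₂)
        (dirDeriv (fieldRep p E₂) (dirDeriv (fieldRep p E₂) (chartRep p Φ))) z := fun z hz =>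
    (chartRep_flatDeriv (hE.contMDiff_flatAccel hI) E₂ hz).trans (dirDeriv_congr oT r₂ hz)
  have hz' := mem_extChartAt_target (I := 𝓡 2) p
  rwa [← r₃ _ hz', ← r₂ _ hz', ← r₁ _ hz', chartRep_extChartAt hp, chartRep_extChartAt hp,
    chartRep_extChartAt hp] at key

end BiconservativeSurface

/-! ### Circles in Minkowski space -/

section Circle

theorem exists_sin_cos_eq {a b : ℝ} (h : a ^ 2 + b ^ 2 = 1) :
    ∃ θ : ℝ, Real.sin θ = a ∧ Real.cos θ = b := by
  have h1 : ‖(⟨b, a⟩ : ℂ)‖ = 1 := by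
    rw [Complex.norm_def, Complex.normSq_mk, Real.sqrt_eq_one]
    linarith
  have h2 : (⟨b, a⟩ : ℂ) ≠ 0 := fun h0 => by
    rw [h0, norm_zero] at h1
    exact zero_ne_one h1
  exact ⟨Complex.arg ⟨b, a⟩, by rw [Complex.sin_arg, h1, div_one],
    by rw [Complex.cos_arg h2, h1, div_one]⟩

variable {κ : ℝ} {B₀ B₁ B₂ : Mink}

theorem lor_comb (h₁₂ : lor B₁ B₂ = 0) (h₁ : lor B₁ B₁ = 1 / κ ^ 2) (h₂ : lor B₂ B₂ = 1 / κ ^ 2)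
    (a b : ℝ) : lor (a • B₁ + b • B₂) (a • B₁ + b • B₂) = (a ^ 2 + b ^ 2) * (1 / κ ^ 2) := by
  have h₂₁ := h₁₂
  rw [lor_comm] at h₂₁
  simp only [lor_add_left, lor_add_right, lor_smul_left, lor_smul_right, h₁₂, h₁, h₂, h₂₁]
  ring

theorem isEuclideanPlane_mk' (hκ : 0 < κ) (h₁₂ : lor B₁ B₂ = 0) (h₁ : lor B₁ B₁ = 1 / κ ^ 2)
    (h₂ : lor B₂ B₂ = 1 / κ ^ 2) :
    IsEuclideanPlane (AffineSubspace.mk' B₀ (Submodule.span ℝ {B₁, B₂})) := by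
  have hk : 0 < 1 / κ ^ 2 := by positivity
  rw [IsEuclideanPlane, AffineSubspace.direction_mk']
  constructor
  · have hli : LinearIndependent ℝ ![B₁, B₂] := by
      rw [LinearIndependent.pair_iff]
      intro a b hab
      have h := lor_comb h₁₂ h₁ h₂ a b
      rw [hab, lor_zero_left] at h
      have h3 : a ^ 2 + b ^ 2 = 0 := (mul_eq_zero.1 h.symm).resolve_right hk.ne'
      constructor <;> nlinarith [sq_nonneg a, sq_nonneg b]
    have h := finrank_span_eq_card hli
    rwa [Matrix.range_cons_cons_empty] at h
  · intro w hw hw0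
    obtain ⟨a, b, rfl⟩ := Submodule.mem_span_pair.1 hw
    rw [lor_comb h₁₂ h₁ h₂]
    refine mul_pos ?_ hk
    rcases eq_or_ne a 0 with rfl | ha
    · have hb : b ≠ 0 := fun hb => hw0 (by simp [hb])
      positivity
    · positivity

theorem mem_circleIn_iff (hκ : 0 < κ) (h₁₂ : lor B₁ B₂ = 0) (h₁ : lor B₁ B₁ = 1 / κ ^ 2)
    (h₂ : lor B₂ B₂ = 1 / κ ^ 2) (x : Mink) :
    x ∈ circleIn (AffineSubspace.mk' B₀ (Submodule.span ℝ {B₁, B₂})) B₀ (1 / κ) ↔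
      ∃ θ : ℝ, x = B₀ + Real.sin θ • B₁ + Real.cos θ • B₂ := by
  have hk : 1 / κ ^ 2 ≠ 0 := by positivity
  rw [circleIn, Set.mem_ofPred_eq, AffineSubspace.mem_mk', vsub_eq_sub, Submodule.mem_span_pair]
  constructor
  · rintro ⟨⟨a, b, hab⟩, hr⟩
    rw [← hab, lor_comb h₁₂ h₁ h₂, div_pow, one_pow] at hr
    have h3 : a ^ 2 + b ^ 2 = 1 := by
      refine mul_right_cancel₀ hk ?_
      rw [hr, one_mul]
    obtain ⟨θ, rfl, rfl⟩ := exists_sin_cos_eq h3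
    refine ⟨θ, ?_⟩
    rw [add_assoc, hab]
    abel
  · rintro ⟨θ, rfl⟩
    have h3 : B₀ + Real.sin θ • B₁ + Real.cos θ • B₂ - B₀
        = Real.sin θ • B₁ + Real.cos θ • B₂ := by abel
    refine ⟨⟨_, _, h3.symm⟩, ?_⟩
    rw [h3, lor_comb h₁₂ h₁ h₂, Real.sin_sq_add_cos_sq, one_mul, div_pow, one_pow]

theorem image_eq_circleIn (hκ : 0 < κ) (h₁₂ : lor B₁ B₂ = 0) (h₁ : lor B₁ B₁ = 1 / κ ^ 2)
    (h₂ : lor B₂ B₂ = 1 / κ ^ 2) {c : ℝ → Mink} {J : Set ℝ}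
    (hc : ∀ v ∈ J, c v = B₀ + Real.sin (κ * v) • B₁ + Real.cos (κ * v) • B₂) :
    c '' J ⊆ circleIn (AffineSubspace.mk' B₀ (Submodule.span ℝ {B₁, B₂})) B₀ (1 / κ) ∧
    ((∃ a, Set.Ico a (a + 2 * Real.pi / κ) ⊆ J) →
      c '' J = circleIn (AffineSubspace.mk' B₀ (Submodule.span ℝ {B₁, B₂})) B₀ (1 / κ)) := by
  have hsub : c '' J ⊆ circleIn (AffineSubspace.mk' B₀ (Submodule.span ℝ {B₁, B₂})) B₀ (1 / κ) := by
    rintro _ ⟨v, hv, rfl⟩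
    exact (mem_circleIn_iff hκ h₁₂ h₁ h₂ _).2 ⟨κ * v, hc v hv⟩
  refine ⟨hsub, fun ⟨a, ha⟩ => hsub.antisymm fun x hx => ?_⟩
  obtain ⟨θ, rfl⟩ := (mem_circleIn_iff hκ h₁₂ h₁ h₂ _).1 hx
  have hp : 0 < 2 * Real.pi / κ := by positivity
  -- The parameter `θ / κ` is reduced modulo the period `2π / κ` into the half-open interval
  -- contained in `J`.
  have hm := toIcoMod_mem_Ico hp a (θ / κ)
  have he : κ * toIcoMod hp a (θ / κ) = θ - toIcoDiv hp a (θ / κ) * (2 * Real.pi) := by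
    rw [toIcoMod, zsmul_eq_mul]
    field_simp
  refine ⟨_, ha hm, ?_⟩
  rw [hc _ (ha hm), he, Real.sin_sub_int_mul_two_pi, Real.cos_sub_int_mul_two_pi]

/-- The solution of the system `c' = e`, `e' = κ ξ`, `ξ' = -κ e`. -/
theorem circle_ode {J : Set ℝ} (hJ : IsOpen J) (hJ' : J.OrdConnected) (h0 : (0 : ℝ) ∈ J)
    (hκ : κ ≠ 0) {c e ξ : ℝ → Mink} (hc : ∀ v ∈ J, HasDerivAt c (e v) v)
    (he : ∀ v ∈ J, HasDerivAt e (κ • ξ v) v) (hξ : ∀ v ∈ J, HasDerivAt ξ (-(κ • e v)) v)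
    {v : ℝ} (hv : v ∈ J) :
    c v = (c 0 + (1 / κ) • ξ 0) + Real.sin (κ * v) • ((1 / κ) • e 0)
      + Real.cos (κ * v) • (-((1 / κ) • ξ 0)) := by
  have const : ∀ {F : ℝ → Mink}, (∀ v ∈ J, HasDerivAt F 0 v) → F v = F 0 := fun hF =>
    hJ.is_const_of_deriv_eq_zero hJ'.isPreconnected
      (fun v hv => (hF v hv).differentiableAt.differentiableWithinAt)
      (fun v hv => (hF v hv).deriv) hv h0
  have hs : ∀ v, HasDerivAt (fun v => Real.sin (κ * v)) (Real.cos (κ * v) * κ) v := fun v => by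
    simpa using ((hasDerivAt_id v).const_mul κ).sin
  have hco : ∀ v, HasDerivAt (fun v => Real.cos (κ * v)) (-Real.sin (κ * v) * κ) v := fun v => by
    simpa using ((hasDerivAt_id v).const_mul κ).cos
  -- First integrals: `h1` is the centre of the circle, `h2` and `h3` are `ξ` and `e` rotated back
  -- by the angle `κv`. Inverting the rotation recovers `ξ v`, and then `h1` gives `c v`.
  have h1 := const (F := fun v => c v + (1 / κ) • ξ v) fun v hv => by
    refine ((hc v hv).add ((hξ v hv).const_smul (1 / κ))).congr_deriv ?_
    rw [smul_neg, smul_smul, one_div_mul_cancel hκ, one_smul, add_neg_cancel]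
  have h2 := const (F := fun v => Real.cos (κ * v) • ξ v + Real.sin (κ * v) • e v) fun v hv => by
    refine (((hco v).smul (hξ v hv)).add ((hs v).smul (he v hv))).congr_deriv ?_
    module
  have h3 := const (F := fun v => Real.cos (κ * v) • e v - Real.sin (κ * v) • ξ v) fun v hv => by
    refine (((hco v).smul (he v hv)).sub ((hs v).smul (hξ v hv))).congr_deriv ?_
    module
  simp only [mul_zero, Real.cos_zero, Real.sin_zero, one_smul, zero_smul, add_zero, sub_zero]
    at h1 h2 h3
  have h4 : ξ v = Real.cos (κ * v) • ξ 0 - Real.sin (κ * v) • e 0 := by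
    rw [← h2, ← h3]
    have h5 : (Real.sin (κ * v) ^ 2 + Real.cos (κ * v) ^ 2) • ξ v = ξ v := by
      rw [Real.sin_sq_add_cos_sq, one_smul]
    nth_rw 1 [← h5]
    module
  linear_combination (norm := module) h1 - (1 / κ) • h4

end Circle

/-! ### The curvature and `ξ` along integral curves of `E₂`. -/

section IntegralCurves

variable {M : Type*} [TopologicalSpace M] [ChartedSpace (EuclideanSpace ℝ (Fin 2)) M]
  [IsManifold (𝓡 2) ∞ M] {Φ : M → Mink} {E₂ : (p : M) → TangentSpace (𝓡 2) p}

theorem hasDerivAt_comp_integralCurve {V : M → Mink} (hV : ContMDiff (𝓡 2) 𝓘(ℝ, Mink) ∞ V)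
    {γ : ℝ → M} {J : Set ℝ} (hJ : IsOpen J) (hγ : IsMIntegralCurveOn γ E₂ J) {t : ℝ} (ht : t ∈ J) :
    HasDerivAt (V ∘ γ) (flatDeriv V (γ t) (E₂ (γ t))) t := by
  have h1 := (hγ t ht).hasMFDerivAt (hJ.mem_nhds ht)
  have h2 := ((hV (γ t)).mdifferentiableAt (by simp)).hasMFDerivAt.comp t h1
  have h3 : HasFDerivAt (V ∘ γ)
      ((flatDeriv V (γ t)).comp ((1 : ℝ →L[ℝ] ℝ).smulRight (E₂ (γ t)))) t :=
    hasMFDerivAt_iff_hasFDerivAt.1 h2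
  refine h3.hasDerivAt.congr_deriv ?_
  change flatDeriv V (γ t) ((1 : ℝ) • E₂ (γ t)) = _
  rw [one_smul]

theorem IsFieldE₂.lor_flatAccel_push (hE : IsFieldE₂ Φ E₂) (hΦ : IsHypImmersion Φ) (p : M) :
    lor (flatAccel Φ E₂ p) (push Φ E₂ p) = 0 := by
  have h1 := lor_flatDeriv_of_const (hE.contMDiff_push hΦ p) (hE.contMDiff_push hΦ p) hE.unit
    (E₂ p)
  change lor (flatAccel Φ E₂ p) _ = -lor _ (flatAccel Φ E₂ p) at h1
  rw [lor_comm (push Φ E₂ p)] at h1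
  linarith

/-- `⟨∇̂_{E₂} E₂, ∇̂_{E₂} E₂⟩` is constant in the direction `E₂`. -/
theorem IsPNMCBiconservative.lor_flatDeriv_flatAccel (hΦ : IsPNMCBiconservative Φ)
    (hE : IsFieldE₂ Φ E₂) (p : M) :
    lor (flatDeriv (flatAccel Φ E₂) p (E₂ p)) (flatAccel Φ E₂ p) = 0 := by
  rw [hΦ.flatDeriv_flatAccel hE, lor_smul_left, lor_comm (push Φ E₂ p),
    hE.lor_flatAccel_push hΦ.isHypImmersion, mul_zero]

theorem kappaHat_sq {p : M} (h : 0 < lor (flatAccel Φ E₂ p) (flatAccel Φ E₂ p)) :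
    kappaHat Φ E₂ p * kappaHat Φ E₂ p = lor (flatAccel Φ E₂ p) (flatAccel Φ E₂ p) := by
  rw [kappaHat, Real.mul_self_sqrt (abs_nonneg _), abs_of_pos h]

theorem kappaHat_pos {p : M} (h : 0 < lor (flatAccel Φ E₂ p) (flatAccel Φ E₂ p)) :
    0 < kappaHat Φ E₂ p :=
  Real.sqrt_pos.2 (abs_pos_of_pos h)

/-- Spacelikeness removes the absolute value in `κ̂` and keeps the square root away from zero. -/
theorem IsFieldE₂.contMDiff_xiField (hE : IsFieldE₂ Φ E₂) (hΦ : IsHypImmersion Φ)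
    (hs : ∀ p, 0 < lor (flatAccel Φ E₂ p) (flatAccel Φ E₂ p)) :
    ContMDiff (𝓡 2) 𝓘(ℝ, Mink) ∞ (xiField Φ E₂) := by
  intro p
  have hp := mem_extChartAt_source (I := 𝓡 2) p
  have h1 := contDiffAt_chartRep hp (hE.contMDiff_flatAccel hΦ p)
  have h2 : ContDiffAt ℝ ∞ (fun z => √(lor (chartRep p (flatAccel Φ E₂) z)
      (chartRep p (flatAccel Φ E₂) z))) (extChartAt (𝓡 2) p p) := (h1.lor h1).sqrt (hs _).ne'
  have h3 : chartRep p (xiField Φ E₂) = fun z =>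
      (1 / √(lor (chartRep p (flatAccel Φ E₂) z) (chartRep p (flatAccel Φ E₂) z)))
        • chartRep p (flatAccel Φ E₂) z := by
    funext z
    rw [chartRep, xiField, kappaHat, abs_of_pos (hs _)]
    rfl
  refine contMDiffAt_of_chartRep hp ?_
  rw [h3]
  exact (contDiffAt_const.div h2 (Real.sqrt_pos.2 (hs _)).ne').smul h1

theorem kappaHat_smul_xiField {p : M} (h : 0 < lor (flatAccel Φ E₂ p) (flatAccel Φ E₂ p)) :
    kappaHat Φ E₂ p • xiField Φ E₂ p = flatAccel Φ E₂ p := by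
  rw [xiField, smul_smul, mul_one_div_cancel (kappaHat_pos h).ne', one_smul]

theorem lor_xiField {p : M} (h : 0 < lor (flatAccel Φ E₂ p) (flatAccel Φ E₂ p)) :
    lor (xiField Φ E₂ p) (xiField Φ E₂ p) = 1 := by
  have := (kappaHat_pos h).ne'
  rw [xiField, lor_smul_left, lor_smul_right, ← kappaHat_sq h]
  field_simp

/-- `∇̂_{E₂} ξ = -κ̂ E₂`. -/
theorem IsPNMCBiconservative.flatDeriv_xiField (hΦ : IsPNMCBiconservative Φ)
    (hE : IsFieldE₂ Φ E₂) (hs : ∀ p, 0 < lor (flatAccel Φ E₂ p) (flatAccel Φ E₂ p)) (p : M) :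
    flatDeriv (xiField Φ E₂) p (E₂ p) = -(kappaHat Φ E₂ p • push Φ E₂ p) := by
  have hI := hΦ.isHypImmersion
  have hp := mem_extChartAt_source (I := 𝓡 2) p
  set z := extChartAt (𝓡 2) p p with hz
  set η := chartRep p (flatAccel Φ E₂) with hη
  set x := chartDiff p p (E₂ p) with hx
  have dη : DifferentiableAt ℝ η z := differentiableAt_chartRep hp (hE.contMDiff_flatAccel hI p)
  have ηz : η z = flatAccel Φ E₂ p := chartRep_extChartAt hp _
  have e1 : flatDeriv (flatAccel Φ E₂) p (E₂ p) = fderiv ℝ η z x :=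
    flatDeriv_eq_fderiv_chartRep hp ((hE.contMDiff_flatAccel hI p).mdifferentiableAt (by simp)) _
  have e2 : flatDeriv (xiField Φ E₂) p (E₂ p) = fderiv ℝ (chartRep p (xiField Φ E₂)) z x :=
    flatDeriv_eq_fderiv_chartRep hp ((hE.contMDiff_xiField hI hs p).mdifferentiableAt (by simp)) _
  have h3 : chartRep p (xiField Φ E₂) = fun z => (1 / √(lor (η z) (η z))) • η z := by
    funext z
    rw [chartRep, xiField, kappaHat, abs_of_pos (hs _)]
    rfl
  have hg := dη.lor dη
  have hpos : 0 < lor (η z) (η z) := hs _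
  -- The normalizing factor of `ξ` is stationary along `E₂`, so only the derivative of `∇̂_{E₂}E₂`
  -- contributes.
  have dg : fderiv ℝ (fun z => lor (η z) (η z)) z x = 0 := by
    have h4 := hΦ.lor_flatDeriv_flatAccel hE p
    rw [fderiv_lor dη dη, ← e1, ηz, lor_comm (flatAccel Φ E₂ p), h4, add_zero]
  have dh : DifferentiableAt ℝ (fun s : ℝ => 1 / √s) (lor (η z) (η z)) :=
    (differentiableAt_const _).div (Real.hasDerivAt_sqrt hpos.ne').differentiableAt (Real.sqrt_pos.2 hpos).ne'
  have dc : DifferentiableAt ℝ (fun z => 1 / √(lor (η z) (η z))) z :=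
    DifferentiableAt.comp (g := fun s : ℝ => 1 / √s) z dh hg
  have fc : fderiv ℝ (fun z => 1 / √(lor (η z) (η z))) z x = 0 := by
    have h5 := fderiv_comp (g := fun s : ℝ => 1 / √s) z dh hg
    change fderiv ℝ (fun z => 1 / √(lor (η z) (η z))) z = _ at h5
    rw [h5, ContinuousLinearMap.comp_apply, dg, map_zero]
  have hk : √(lor (η z) (η z)) = kappaHat Φ E₂ p := by
    rw [ηz, kappaHat, abs_of_pos (hs p)]
  rw [e2, h3, fderiv_fun_smul dc dη]
  simp only [add_apply, smul_apply, ContinuousLinearMap.smulRight_apply, fc, zero_smul, add_zero]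
  rw [← e1, hΦ.flatDeriv_flatAccel hE, hk, ← kappaHat_sq (hs p), smul_smul, ← neg_smul]
  congr 1
  have := (kappaHat_pos (hs p)).ne'
  field_simp

/-- Along the curve the derivative of `⟨∇̂_{E₂}E₂, ∇̂_{E₂}E₂⟩` is a multiple of `⟨E₂, ∇̂_{E₂}E₂⟩ =
0`; `J` is an interval. -/
theorem IsPNMCBiconservative.kappaHat_const (hΦ : IsPNMCBiconservative Φ)
    (hE : IsFieldE₂ Φ E₂) {γ : ℝ → M} {J : Set ℝ} (hJ : IsOpen J) (hJ' : J.OrdConnected)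
    (hγ : IsMIntegralCurveOn γ E₂ J) {s t : ℝ} (hs : s ∈ J) (ht : t ∈ J) :
    kappaHat Φ E₂ (γ s) = kappaHat Φ E₂ (γ t) := by
  have hd : ∀ v ∈ J, HasDerivAt (fun v => lor (flatAccel Φ E₂ (γ v)) (flatAccel Φ E₂ (γ v))) 0 v := by
    intro v hv
    have h1 := hasDerivAt_comp_integralCurve (hE.contMDiff_flatAccel hΦ.isHypImmersion) hJ hγ hv
    have h2 := h1.differentiableAt
    have h3 := fderiv_lor h2 h2 1
    have h4 : fderiv ℝ (flatAccel Φ E₂ ∘ γ) v 1 = _ := h1.deriv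
    rw [h4] at h3
    have h5 := hΦ.lor_flatDeriv_flatAccel hE (γ v)
    refine (h2.lor h2).hasDerivAt.congr_deriv ?_
    change fderiv ℝ _ v 1 = 0
    rw [h3]
    change lor _ (flatAccel Φ E₂ (γ v)) + lor (flatAccel Φ E₂ (γ v)) _ = 0
    rw [lor_comm (flatAccel Φ E₂ (γ v)), h5, add_zero]
  have := hJ.is_const_of_deriv_eq_zero hJ'.isPreconnected
    (fun v hv => (hd v hv).differentiableAt.differentiableWithinAt)
    (fun v hv => (hd v hv).deriv) hs ht
  rw [kappaHat, kappaHat, this]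

theorem IsFieldE₂.curveCurvature_eq (hE : IsFieldE₂ Φ E₂) (hΦ : IsHypImmersion Φ) {γ : ℝ → M}
    {J : Set ℝ} (hJ : IsOpen J) (hγ : IsMIntegralCurveOn γ E₂ J) {v : ℝ} (hv : v ∈ J) :
    curveCurvature (Φ ∘ γ) v = kappaHat Φ E₂ (γ v) := by
  have h1 : deriv (Φ ∘ γ) =ᶠ[nhds v] push Φ E₂ ∘ γ := by
    filter_upwards [hJ.mem_nhds hv] with t ht
    exact (hasDerivAt_comp_integralCurve hΦ.smooth hJ hγ ht).deriv
  rw [curveCurvature, h1.deriv_eq,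
    (hasDerivAt_comp_integralCurve (hE.contMDiff_push hΦ) hJ hγ hv).deriv]
  rfl

end IntegralCurves

end PNMC

end

theorem mainTheorem6 {M : Type*} [TopologicalSpace M]
    [ChartedSpace (EuclideanSpace ℝ (Fin 2)) M] [IsManifold (𝓡 2) ∞ M]
    (Φ : M → PNMC.Mink) (hΦ : PNMC.IsPNMCBiconservative Φ)
    (E₂ : (p : M) → TangentSpace (𝓡 2) p) (hE₂ : PNMC.IsFieldE₂ Φ E₂)
    (hspacelike : ∀ p, 0 < PNMC.lor (PNMC.flatAccel Φ E₂ p) (PNMC.flatAccel Φ E₂ p)) :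
    (∀ p, PNMC.flatDeriv (PNMC.xiField Φ E₂) p (E₂ p)
        = -(PNMC.kappaHat Φ E₂ p • PNMC.push Φ E₂ p)) ∧
    ∀ (γ : ℝ → M) (J : Set ℝ), IsOpen J → J.OrdConnected → (0 : ℝ) ∈ J →
      IsMIntegralCurveOn γ E₂ J →
      ∃ κ : ℝ, 0 < κ ∧
        (∀ v ∈ J, PNMC.kappaHat Φ E₂ (γ v) = κ ∧ PNMC.curveCurvature (Φ ∘ γ) v = κ) ∧
        ∃ B₀ B₁ B₂ : PNMC.Mink,
          B₀ = Φ (γ 0) + (1 / κ) • PNMC.xiField Φ E₂ (γ 0) ∧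
          B₁ = (1 / κ) • PNMC.push Φ E₂ (γ 0) ∧
          B₂ = -((1 / κ) • PNMC.xiField Φ E₂ (γ 0)) ∧
          (∀ v ∈ J, Φ (γ v) = B₀ + Real.sin (κ * v) • B₁ + Real.cos (κ * v) • B₂) ∧
          PNMC.lor B₁ B₂ = 0 ∧
          PNMC.lor B₁ B₁ = 1 / κ ^ 2 ∧
          PNMC.lor B₂ B₂ = 1 / κ ^ 2 ∧
          PNMC.IsEuclideanPlane (AffineSubspace.mk' B₀ (Submodule.span ℝ {B₁, B₂})) ∧
          (Φ ∘ γ) '' J ⊆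
            PNMC.circleIn (AffineSubspace.mk' B₀ (Submodule.span ℝ {B₁, B₂})) B₀ (1 / κ) ∧
          ((∃ a, Set.Ico a (a + 2 * Real.pi / κ) ⊆ J) →
            (Φ ∘ γ) '' J =
              PNMC.circleIn (AffineSubspace.mk' B₀ (Submodule.span ℝ {B₁, B₂})) B₀ (1 / κ)) := by
  have hI := hΦ.isHypImmersion
  refine ⟨hΦ.flatDeriv_xiField hE₂ hspacelike, fun γ J hJ hJ' h0 hγ => ?_⟩
  have hk : ∀ v ∈ J, PNMC.kappaHat Φ E₂ (γ v) = PNMC.kappaHat Φ E₂ (γ 0) := fun v hv =>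
    hΦ.kappaHat_const hE₂ hJ hJ' hγ hv h0
  set κ := PNMC.kappaHat Φ E₂ (γ 0) with hκ
  have kpos : 0 < κ := PNMC.kappaHat_pos (hspacelike _)
  have hc : ∀ v ∈ J, Φ (γ v) = (Φ (γ 0) + (1 / κ) • PNMC.xiField Φ E₂ (γ 0))
      + Real.sin (κ * v) • ((1 / κ) • PNMC.push Φ E₂ (γ 0))
      + Real.cos (κ * v) • (-((1 / κ) • PNMC.xiField Φ E₂ (γ 0))) := fun v hv =>
    PNMC.circle_ode (c := Φ ∘ γ) (e := PNMC.push Φ E₂ ∘ γ) (ξ := PNMC.xiField Φ E₂ ∘ γ)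
      hJ hJ' h0 kpos.ne'
      (fun t ht => PNMC.hasDerivAt_comp_integralCurve hI.smooth hJ hγ ht)
      (fun t ht => (PNMC.hasDerivAt_comp_integralCurve (hE₂.contMDiff_push hI) hJ hγ
        ht).congr_deriv (by
          rw [← hk t ht]
          exact (PNMC.kappaHat_smul_xiField (hspacelike _)).symm))
      (fun t ht => (PNMC.hasDerivAt_comp_integralCurve (hE₂.contMDiff_xiField hI hspacelike) hJ hγ
        ht).congr_deriv (by
          rw [← hk t ht]
          exact hΦ.flatDeriv_xiField hE₂ hspacelike _)) hv
  have h₁₂ : PNMC.lor ((1 / κ) • PNMC.push Φ E₂ (γ 0)) (-((1 / κ) • PNMC.xiField Φ E₂ (γ 0))) = 0 := by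
    rw [PNMC.lor_neg_right, PNMC.lor_smul_left, PNMC.lor_smul_right, PNMC.xiField,
      PNMC.lor_smul_right, PNMC.lor_comm, hE₂.lor_flatAccel_push hI]
    simp
  have h₁ : PNMC.lor ((1 / κ) • PNMC.push Φ E₂ (γ 0)) ((1 / κ) • PNMC.push Φ E₂ (γ 0))
      = 1 / κ ^ 2 := by
    have h := hE₂.unit (γ 0)
    change PNMC.lor (PNMC.push Φ E₂ (γ 0)) (PNMC.push Φ E₂ (γ 0)) = 1 at h
    rw [PNMC.lor_smul_left, PNMC.lor_smul_right, h]
    field_simp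
  have h₂ : PNMC.lor (-((1 / κ) • PNMC.xiField Φ E₂ (γ 0))) (-((1 / κ) • PNMC.xiField Φ E₂ (γ 0)))
      = 1 / κ ^ 2 := by
    rw [PNMC.lor_neg_left, PNMC.lor_neg_right, PNMC.lor_smul_left, PNMC.lor_smul_right,
      PNMC.lor_xiField (hspacelike _)]
    field_simp
  have him := PNMC.image_eq_circleIn kpos h₁₂ h₁ h₂ (c := Φ ∘ γ) hc
  exact ⟨κ, kpos, fun v hv => ⟨hk v hv, (hE₂.curveCurvature_eq hI hJ hγ hv).trans (hk v hv)⟩,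
    _, _, _, rfl, rfl, rfl, hc, h₁₂, h₁, h₂, PNMC.isEuclideanPlane_mk' kpos h₁₂ h₁ h₂,
    him.1, him.2⟩
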